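/- Let $n\ge 3$ and let $G=\mathrm{Hol}(C_{2^n})=C_{2^n}\rtimes\mathrm{Aut}(C_{2^n})$, let $G'$ be its commutator subgroup, let $a\in G$ generate the normal subgroup $C_{2^n}$, and let $b\in\mathrm{Aut}(C_{2^n})$ be the element with $b^{-1}ab=a^5$. For $m\ge1$ let $\Phi_m(X)$ denote the $m$-th cyclotomic polynomial. 1. The set of equivalence classes of irreducible $\mathbb{Q}$-representations of $G$ whose kernel contains $G'$ is in bijective correspondence with the set of Galois conjugacy classes (over $\mathbb{Q}$) of complex degree-one representations of $G$; under this correspondence the class attached to $\rho$ consists of the degree-one constituents of $\rho\otimes_{\mathbb{Q}}\mathbb{C}$. The number of such irreducible $\mathbb{Q}$-representations is $4(n-1)$. 2. The set of equivalence classes of irreducible $\mathbb{Q}$-representations of $G$ whose kernel does not contain $G'$ is in bijective correspondence with the disjoint union over $k\in\{2,\dots,n\}$ of the sets $\{\Phi_1,\Phi_2,\Phi_4,\dots,\Phi_{2^{n-k}}\}$, that is, with the pairs $(k,\Phi_{2^i})$ where $2\le k\le n$ and $0\le i\le n-k$. Under this correspondence, $\rho$ is attached to $(k,\Phi_{2^i})$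 if and only if the following holds for one (equivalently, every) primitive $2^k$-th root of unity $\zeta\in\mathbb{C}$ and one (equivalently, every) root $\omega\in\mathbb{C}$ of $\Phi_{2^i}$: there is a unique linear character of $\langle a,b^{2^{k-2}}\rangle$ with $a\mapsto\zeta$ and $b^{2^{k-2}}\mapsto\omega$, and the representation of $G$ induced from it is an irreducible constituent of $\rho\otimes_{\mathbb{Q}}\mathbb{C}$. 3. The total number of equivalence classes of irreducible $\mathbb{Q}$-representations of $G$ is $4(n-1)+\frac{n(n-1)}{2}$. -/

import Mathlib

open scoped TensorProduct

/-! ### Isomorphism classes of irreducible representations -/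

/-- A finite-dimensional irreducible representation of `G` over the field `F`. -/
structure Irrep (F : Type) [Field F] (G : Type) [Group G] where
  /-- the underlying vector space -/
  V : Type
  [addCommGroup : AddCommGroup V]
  [module : Module F V]
  [finiteDimensional : FiniteDimensional F V]
  /-- the action of `G` -/
  rep : Representation F G V
  irreducible : rep.IsIrreducible

attribute [instance] Irrep.addCommGroup Irrep.module Irrep.finiteDimensional

/-- Equivalence of representations. -/
instance Irrep.setoid (F : Type) [Field F] (G : Type) [Group G] : Setoid (Irrep F G) where
  r ρ σ := Nonempty (ρ.rep.Equiv σ.rep)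
  iseqv :=
    { refl := fun ρ => ⟨Representation.Equiv.refl ρ.rep⟩
      symm := fun ⟨e⟩ => ⟨e.symm⟩
      trans := fun ⟨e⟩ ⟨f⟩ => ⟨e.trans f⟩ }

/-- The inequivalent irreducible representations of `G` over `F`. -/
abbrev IrrepClass (F : Type) [Field F] (G : Type) [Group G] : Type 1 :=
  Quotient (Irrep.setoid F G)

/-- Equivalent representations have the same kernel. -/
theorem Irrep.ker_eq_of_equiv {F : Type} [Field F] {G : Type} [Group G] {ρ σ : Irrep F G}
    (h : ρ ≈ σ) : MonoidHom.ker ρ.rep = MonoidHom.ker σ.rep := by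
  obtain ⟨e⟩ := h
  ext g
  simp only [MonoidHom.mem_ker]
  constructor
  · intro hg
    rw [← Representation.Equiv.conj_apply_self g e, hg]
    exact LinearEquiv.conj_id _
  · intro hg
    rw [← Representation.Equiv.conj_apply_self g e.symm, hg]
    exact LinearEquiv.conj_id _

/-- The kernel of an equivalence class of irreducible representations. -/
def IrrepClass.ker {F : Type} [Field F] {G : Type} [Group G] (π : IrrepClass F G) : Subgroup G :=
  Quotient.lift (fun ρ : Irrep F G => MonoidHom.ker ρ.rep)
    (fun _ _ h => Irrep.ker_eq_of_equiv h) π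

/-! ### Complexification and constituents -/

/-- The complex representation `ℂ ⊗ V` obtained from a rational representation `V`. -/
noncomputable def complexify {G V : Type} [Group G] [AddCommGroup V] [Module ℚ V]
    (ρ : Representation ℚ G V) : Representation ℂ G (ℂ ⊗[ℚ] V) where
  toFun g := (ρ g).baseChange ℂ
  map_one' := by rw [map_one]; exact LinearMap.baseChange_id
  map_mul' g h := by rw [map_mul]; exact LinearMap.baseChange_comp _ _

/-- `σ` is an irreducible constituent of the complex representation `τ`: it is irreducible and
equivalent to a subrepresentation of `τ`. -/
def IsConstituent {G V W : Type} [Group G] [AddCommGroup V] [Module ℂ V] [AddCommGroup W]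
    [Module ℂ W] (σ : Representation ℂ G V) (τ : Representation ℂ G W) : Prop :=
  σ.IsIrreducible ∧ ∃ f : σ.IntertwiningMap τ, Function.Injective f

/-- The degree-one complex representation afforded by a linear character. -/
noncomputable def linearRep {G : Type} [Group G] (χ : G →* ℂˣ) : Representation ℂ G ℂ where
  toFun g := (χ g : ℂ) • LinearMap.id
  map_one' := by ext; simp
  map_mul' g h := by ext; simp [mul_comm]

/-! ### Galois conjugacy of linear characters -/

/-- The character field `ℚ(χ)`, generated by the values of `χ`. -/
noncomputable def characterField {G : Type} [Group G] (χ : G →* ℂˣ) : IntermediateField ℚ ℂ :=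
  IntermediateField.adjoin ℚ (Set.range fun g => (χ g : ℂ))

/-- A value of `χ` as an element of the character field. -/
noncomputable def characterValue {G : Type} [Group G] (χ : G →* ℂˣ) (g : G) : characterField χ :=
  ⟨(χ g : ℂ), IntermediateField.subset_adjoin ℚ _ ⟨g, rfl⟩⟩

/-- The Galois conjugacy class of `χ`: all `σ ∘ χ` with `σ ∈ Gal(ℚ(χ)/ℚ)`. -/
def galoisClass {G : Type} [Group G] (χ : G →* ℂˣ) : Set (G →* ℂˣ) :=
  {ψ | ∃ σ : characterField χ ≃ₐ[ℚ] characterField χ,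
    ∀ g, (ψ g : ℂ) = (σ (characterValue χ g) : ℂ)}

/-- The set of Galois conjugacy classes of complex degree-one representations of `G`. -/
def galoisClasses (G : Type) [Group G] : Set (Set (G →* ℂˣ)) :=
  Set.range galoisClass

/-! ### The holomorph of the cyclic group of order `2 ^ n` -/

/-- The holomorph `C ⋊ Aut(C)` of a group `C`. -/
abbrev Holomorph (C : Type) [Group C] : Type :=
  C ⋊[MonoidHom.id (MulAut C)] MulAut C

/-- The holomorph of the cyclic group of order `2 ^ n`. -/
abbrev HolTwoPow (n : ℕ) : Type :=
  Holomorph (Multiplicative (ZMod (2 ^ n)))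

namespace HolTwoPow

/-- The automorphism `x ↦ x ^ 5` of the cyclic group of order `2 ^ n`. -/
def powFive (n : ℕ) : MulAut (Multiplicative (ZMod (2 ^ n))) :=
  AddEquiv.toMultiplicative
    (AddAut.mulLeft (ZMod.unitOfCoprime 5 (Nat.Coprime.pow_right n (by decide))))

/-- The generator `a` of the cyclic normal subgroup of order `2 ^ n`. -/
def a (n : ℕ) : HolTwoPow n :=
  SemidirectProduct.inl (Multiplicative.ofAdd 1)

/-- The element `b` of the complement, normalised so that `b⁻¹ * a * b = a ^ 5`. -/
def b (n : ℕ) : HolTwoPow n :=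
  SemidirectProduct.inr (powFive n)⁻¹

/-- The subgroup `⟨a, b ^ 2 ^ (k - 2)⟩`, for `2 ≤ k ≤ n` the stabiliser of the characters of
order `2 ^ k` of `⟨a⟩`. -/
def stab (n k : ℕ) : Subgroup (HolTwoPow n) :=
  Subgroup.closure {a n, b n ^ 2 ^ (k - 2)}

/-- `a` as an element of `stab n k`. -/
def stabA (n k : ℕ) : stab n k :=
  ⟨a n, Subgroup.subset_closure (Set.mem_insert _ _)⟩

/-- `b ^ 2 ^ (k - 2)` as an element of `stab n k`. -/
def stabB (n k : ℕ) : stab n k :=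
  ⟨b n ^ 2 ^ (k - 2), Subgroup.subset_closure (Set.mem_insert_of_mem _ rfl)⟩

/-- The disjoint union, over `k = 2, …, n`, of the sets of polynomials
`{Φ_1, Φ_2, Φ_4, …, Φ_{2 ^ (n - k)}}`, as a set of pairs `(k, Φ)`. -/
def cyclotomicPairs (n : ℕ) : Set (ℕ × Polynomial ℚ) :=
  {p | 2 ≤ p.1 ∧ p.1 ≤ n ∧ ∃ i ≤ n - p.1, p.2 = Polynomial.cyclotomic (2 ^ i) ℚ}

end HolTwoPow

/-! ### Eigenvalues of rational operators after extension to `ℂ`. -/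

section Complexification

variable {G V W : Type} [Group G] [AddCommGroup V] [Module ℚ V] [AddCommGroup W] [Module ℚ W]

/-! An irreducible rational representation is recognised by one complex line. If a linear character
`l` of a subgroup `H` satisfies Mackey's criterion, then two irreducible rational representations
whose complexifications both contain an `l`-eigenvector are equivalent: averaging over `G` gives a
nonzero complex intertwiner, this descends to a rational one, and Schur's lemma applies
(`irrep_equiv_of_hasEigenvectorFor`). Every `l` occurs somewhere, because it occurs in the regular
representation. By Frobenius reciprocity, having an `l`-eigenvector means that the induced
representation is a constituent (`isConstituent_ind_iff`). What remains is to decide which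
characters `l` occur in the same `ρ`.

The commutator subgroup is generated by `a ^ 2`. If it acts trivially, take `H = ⊤`: the characters
occurring in `ρ` are those with the same kernel as `ρ`, which form one Galois class. A kernel is
encoded by the signs at `a` and at the complement element `-1` together with the order at `b`, which
gives `2 * 2 * (n - 1)` classes.

Otherwise every eigenvalue of `a` has the same order `2 ^ k`, with `k ≥ 2`. The group `⟨a, b ^ 2 ^
(k - 2)⟩` is the stabiliser of a character of `⟨a⟩` of order `2 ^ k`, which is Mackey's criterion.
Since `a ^ 2 ^ k` acts trivially, `b ^ 2 ^ (k - 2)` acts centrally, so by Schur its eigenvalues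
share one minimal polynomial `Φ_{2 ^ i}`. Conversely all roots of that polynomial occur, and the
complement permutes the primitive `2 ^ k`-th roots transitively. Hence `(k, Φ_{2 ^ i})` is a
complete invariant (`InertialCharacter.occursIn_iff_label_eq`). -/

theorem complexify_apply (ρ : Representation ℚ G V) (g : G) :
    complexify ρ g = (ρ g).baseChange ℂ := rfl

theorem complexify_tmul (ρ : Representation ℚ G V) (g : G) (c : ℂ) (v : V) :
    complexify ρ g (c ⊗ₜ v) = c ⊗ₜ ρ g v := by
  simp [complexify_apply]

theorem baseChange_complexify {ρ : Representation ℚ G V} {σ : Representation ℚ G W}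
    (f : V →ₗ[ℚ] W) (hf : ∀ g v, f (ρ g v) = σ g (f v)) (g : G) (x : ℂ ⊗[ℚ] V) :
    f.baseChange ℂ (complexify ρ g x) = complexify σ g (f.baseChange ℂ x) := by
  have h : f ∘ₗ ρ g = σ g ∘ₗ f := LinearMap.ext fun v => hf g v
  rw [complexify_apply, complexify_apply, ← LinearMap.comp_apply, ← LinearMap.comp_apply,
    ← LinearMap.baseChange_comp, ← LinearMap.baseChange_comp, h]

theorem injective_baseChange {f : V →ₗ[ℚ] W} (hf : Function.Injective f) :
    Function.Injective (f.baseChange ℂ) :=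
  Module.Flat.lTensor_preserves_injective_linearMap (M := ℂ) f hf

/-- An endomorphism with `G`-stable kernel of an irreducible rational representation vanishes as
soon as its complexification is not injective. -/
theorem eq_zero_of_baseChange_apply_eq_zero {ρ : Representation ℚ G V} (hρ : ρ.IsIrreducible)
    (T : V →ₗ[ℚ] W) (hT : ∀ g v, T v = 0 → T (ρ g v) = 0) {x : ℂ ⊗[ℚ] V} (hx : x ≠ 0)
    (hTx : T.baseChange ℂ x = 0) : T = 0 := by
  let K : Subrepresentation ρ := ⟨LinearMap.ker T, fun g v hv => hT g v hv⟩
  rcases hρ.eq_bot_or_eq_top K with hK | hK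
  · have hker : LinearMap.ker T = ⊥ := congrArg Subrepresentation.toSubmodule hK
    refine absurd (injective_baseChange (LinearMap.ker_eq_bot.1 hker) ?_) hx
    rw [hTx, map_zero]
  · have hker : LinearMap.ker T = ⊤ := congrArg Subrepresentation.toSubmodule hK
    exact LinearMap.ker_eq_top.1 hker

/-- The characteristic polynomial of `T` has rational coefficients, so it is divisible by the
minimal polynomial of each of its complex roots. -/
theorem exists_eigenvector_baseChange_of_minpoly_eq [FiniteDimensional ℚ V] (T : Module.End ℚ V)
    {x : ℂ ⊗[ℚ] V} (hx : x ≠ 0) {μ ν : ℂ} (hTx : T.baseChange ℂ x = μ • x)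
    (h : minpoly ℚ μ = minpoly ℚ ν) : ∃ y : ℂ ⊗[ℚ] V, y ≠ 0 ∧ T.baseChange ℂ y = ν • y := by
  have hμ : Module.End.HasEigenvalue (T.baseChange ℂ) μ :=
    Module.End.hasEigenvalue_of_hasEigenvector ⟨Module.End.mem_eigenspace_iff.2 hTx, hx⟩
  rw [Module.End.hasEigenvalue_iff_isRoot_charpoly, LinearMap.charpoly_baseChange,
    Polynomial.IsRoot, Polynomial.eval_map_algebraMap] at hμ
  have hν : Module.End.HasEigenvalue (T.baseChange ℂ) ν := by
    rw [Module.End.hasEigenvalue_iff_isRoot_charpoly, LinearMap.charpoly_baseChange,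
      Polynomial.IsRoot, Polynomial.eval_map_algebraMap]
    obtain ⟨q, hq⟩ := minpoly.dvd ℚ μ hμ
    rw [hq, map_mul, h, minpoly.aeval, zero_mul]
  obtain ⟨y, hy⟩ := hν.exists_hasEigenvector
  exact ⟨y, hy.2, hy.apply_eq_smul⟩

theorem aeval_baseChange_apply (T : Module.End ℚ V) {x : ℂ ⊗[ℚ] V} {μ : ℂ}
    (hTx : T.baseChange ℂ x = μ • x) (p : Polynomial ℚ) :
    (Polynomial.aeval T p).baseChange ℂ x = Polynomial.aeval μ p • x := by
  induction p using Polynomial.induction_on' with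
  | add p q hp hq => simp only [map_add, LinearMap.baseChange_add, LinearMap.add_apply, hp, hq, add_smul]
  | monomial n c =>
    have hpow : ∀ m : ℕ, (T ^ m).baseChange ℂ x = μ ^ m • x := by
      intro m
      induction m with
      | zero => simp
      | succ m ih =>
        rw [pow_succ', Module.End.mul_eq_comp, LinearMap.baseChange_comp, LinearMap.comp_apply, ih,
          map_smul, hTx, smul_smul, pow_succ]
    rw [Polynomial.aeval_monomial, Polynomial.aeval_monomial, Algebra.algebraMap_eq_smul_one,
      smul_mul_assoc, one_mul, LinearMap.baseChange_smul, LinearMap.smul_apply, hpow,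
      Algebra.algebraMap_eq_smul_one, smul_mul_assoc, one_mul, smul_assoc]

/-- All eigenvalues of a self-intertwiner of an irreducible rational representation have the same
minimal polynomial. -/
theorem aeval_minpoly_eq_zero_of_eigenvectors {ρ : Representation ℚ G V} (hρ : ρ.IsIrreducible)
    (T : Module.End ℚ V) (hT : ∀ g v, T (ρ g v) = ρ g (T v)) {x y : ℂ ⊗[ℚ] V} (hx : x ≠ 0)
    (hy : y ≠ 0) {μ ν : ℂ} (hTx : T.baseChange ℂ x = μ • x) (hTy : T.baseChange ℂ y = ν • y)
    {p : Polynomial ℚ} (hp : Polynomial.aeval μ p = 0) : Polynomial.aeval ν p = 0 := by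
  have hcomm : ∀ g, Commute (Polynomial.aeval T p) (ρ g) := fun g => by
    clear hp
    have hg : Commute T (ρ g) := LinearMap.ext fun v => hT g v
    induction p using Polynomial.induction_on' with
    | add p q hp hq => rw [map_add]; exact hp.add_left hq
    | monomial n c =>
      rw [Polynomial.aeval_monomial]
      exact Commute.mul_left (Algebra.commutes c (ρ g)) (hg.pow_left n)
  -- `p(T)` commutes with `G` and kills `x`, so it is zero; evaluating it at `y` then gives `p(ν) •
  -- y = 0`.
  have h0 : Polynomial.aeval T p = 0 := by
    refine eq_zero_of_baseChange_apply_eq_zero hρ _ (fun g v hv => ?_) hx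
      (by rw [aeval_baseChange_apply T hTx, hp, zero_smul])
    have := LinearMap.congr_fun (hcomm g) v
    simp only [Module.End.mul_apply] at this
    rw [this, hv, map_zero]
  have h := aeval_baseChange_apply T hTy p
  rw [h0, LinearMap.baseChange_zero, LinearMap.zero_apply] at h
  exact (smul_eq_zero.1 h.symm).resolve_right hy

end Complexification

/-! ### Isotypic sums for a linear character of a subgroup. -/

section Eigenvectors

variable {G : Type} [Group G] {H : Subgroup G}

/-- The representation `τ` contains a nonzero vector on which `H` acts through `l`. -/
def HasEigenvectorFor {W : Type} [AddCommGroup W] [Module ℂ W] (l : H →* ℂˣ)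
    (τ : Representation ℂ G W) : Prop :=
  ∃ v : W, v ≠ 0 ∧ ∀ h : H, τ h v = (l h : ℂ) • v

/-- Mackey's criterion for the linear character `l` of `H`: no element outside `H` stabilises
`l`. -/
def MackeyCriterion (l : H →* ℂˣ) : Prop :=
  ∀ g ∉ H, ∃ x y : H, (y : G) = g * x * g⁻¹ ∧ l x ≠ l y

variable [Fintype H]

/-- The sum of `l(h)⁻¹ h` over `H`, acting on a representation. -/
noncomputable def isotypicSum {W : Type} [AddCommGroup W] [Module ℂ W] (l : H →* ℂˣ)
    (τ : Representation ℂ G W) : W →ₗ[ℂ] W :=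
  ∑ h : H, ((l h)⁻¹ : ℂˣ).val • τ h

variable {W : Type} [AddCommGroup W] [Module ℂ W] {l : H →* ℂˣ} {τ : Representation ℂ G W}

theorem apply_isotypicSum (h : H) (w : W) :
    τ h (isotypicSum l τ w) = (l h : ℂ) • isotypicSum l τ w := by
  simp only [isotypicSum, LinearMap.sum_apply, map_sum, Finset.smul_sum, LinearMap.smul_apply,
    map_smul]
  refine Fintype.sum_equiv (Equiv.mulLeft h) _ _ fun x => ?_
  rw [smul_smul, Equiv.coe_mulLeft, Subgroup.coe_mul, map_mul τ, Module.End.mul_apply, map_mul,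
    mul_inv, Units.val_mul, ← mul_assoc, Units.mul_inv, one_mul]

theorem isotypicSum_apply (h : H) (w : W) :
    isotypicSum l τ (τ h w) = (l h : ℂ) • isotypicSum l τ w := by
  simp only [isotypicSum, LinearMap.sum_apply, Finset.smul_sum, LinearMap.smul_apply]
  refine Fintype.sum_equiv (Equiv.mulRight h) _ _ fun x => ?_
  rw [smul_smul, Equiv.coe_mulRight, Subgroup.coe_mul, map_mul τ, Module.End.mul_apply, map_mul,
    mul_inv_rev, Units.val_mul, ← mul_assoc, Units.mul_inv, one_mul]

theorem isotypicSum_of_eigenvector {v : W} (hv : ∀ h : H, τ h v = (l h : ℂ) • v) :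
    isotypicSum l τ v = (Fintype.card H : ℂ) • v := by
  simp [isotypicSum, LinearMap.sum_apply, hv, smul_smul, Nat.cast_smul_eq_nsmul]

/-- The element `y = g * x * g⁻¹` multiplies `τ g v` by `l x`, while the sum turns `y` into `l y`;
the two scalars differ. -/
theorem isotypicSum_apply_of_notMem (hl : MackeyCriterion l) {v : W}
    (hv : ∀ h : H, τ h v = (l h : ℂ) • v) {g : G} (hg : g ∉ H) :
    isotypicSum l τ (τ g v) = 0 := by
  obtain ⟨x, y, hy, hne⟩ := hl g hg
  have h1 : τ y (τ g v) = (l x : ℂ) • τ g v := by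
    rw [← Module.End.mul_apply, ← map_mul, hy, inv_mul_cancel_right, map_mul, Module.End.mul_apply,
      hv, map_smul]
  have h2 := isotypicSum_apply (l := l) (τ := τ) y (τ g v)
  rw [h1, map_smul] at h2
  by_contra h0
  exact hne (Units.ext (smul_left_injective ℂ h0 h2))

end Eigenvectors

/-! ### Mackey's irreducibility criterion. -/

section Irreducibility

variable {G : Type} [Group G] [Finite G] {H : Subgroup G} {l : H →* ℂˣ}
variable {W : Type} [AddCommGroup W] [Module ℂ W] {τ : Representation ℂ G W}

/-- A representation spanned by the translates of an eigenvector whose character satisfies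
Mackey's criterion is irreducible. -/
theorem isIrreducible_of_span_eigenvector (hl : MackeyCriterion l) {e : W} (he0 : e ≠ 0)
    (he : ∀ h : H, τ h e = (l h : ℂ) • e)
    (hspan : Submodule.span ℂ (Set.range fun g => τ g e) = ⊤) : τ.IsIrreducible := by
  classical
  have := Fintype.ofFinite G
  let P := isotypicSum l τ
  have hcard : (Fintype.card H : ℂ) ≠ 0 := by simp
  have hPe : ∀ g ∈ H, ∃ c : ℂ, P (τ g e) = c • e := fun g hg => by
    refine ⟨(l ⟨g, hg⟩ : ℂ) * (Fintype.card H : ℂ), ?_⟩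
    rw [he ⟨g, hg⟩, map_smul, isotypicSum_of_eigenvector he, smul_smul]
  -- Translates of `e` by `H` are multiples of `e`, and `P` kills all the others.
  have hPspan : ∀ w, P w ∈ Submodule.span ℂ {e} := by
    intro w
    have hw : w ∈ Submodule.span ℂ (Set.range fun g => τ g e) := hspan ▸ Submodule.mem_top
    induction hw using Submodule.span_induction with
    | mem x hx =>
      obtain ⟨g, rfl⟩ := hx
      by_cases hg : g ∈ H
      · obtain ⟨c, hc⟩ := hPe g hg
        exact hc ▸ Submodule.smul_mem _ _ (Submodule.mem_span_singleton_self e)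
      · simp only [P]
        rw [isotypicSum_apply_of_notMem hl he hg]
        exact Submodule.zero_mem _
    | zero => simp
    | add x y _ _ hx hy => rw [map_add]; exact Submodule.add_mem _ hx hy
    | smul c x _ hx => rw [map_smul]; exact Submodule.smul_mem _ _ hx
  -- Averaging `P` gives an intertwiner. It scales the generator `e` by `|H| ^ 2`, hence is that
  -- scalar everywhere. A subrepresentation killed by `P` is killed by `Z`, so it is zero; any other
  -- one contains `e`.
  let Z : W →ₗ[ℂ] W := ∑ g : G, τ g ∘ₗ P ∘ₗ τ g⁻¹
  have hZcomm : ∀ x w, Z (τ x w) = τ x (Z w) := by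
    intro x w
    simp only [Z, LinearMap.sum_apply, map_sum, LinearMap.comp_apply]
    refine Fintype.sum_equiv (Equiv.mulLeft x⁻¹) _ _ fun g => ?_
    simp only [Equiv.coe_mulLeft, ← Module.End.mul_apply, ← map_mul, mul_inv_rev, inv_inv]
    simp only [Module.End.mul_apply]
    rw [← Module.End.mul_apply (τ x), ← map_mul, mul_inv_cancel_left]
  have hZe : Z e = ((Fintype.card H : ℂ) * (Fintype.card H : ℂ)) • e := by
    have hterm : ∀ g : G, (τ g ∘ₗ P ∘ₗ τ g⁻¹) e
        = if g ∈ H then (Fintype.card H : ℂ) • e else 0 := by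
      intro g
      simp only [LinearMap.comp_apply]
      split_ifs with hg
      · have := he ⟨g⁻¹, H.inv_mem hg⟩
        simp only at this
        rw [this, map_smul, isotypicSum_of_eigenvector he, map_smul, map_smul, he ⟨g, hg⟩,
          smul_comm (l _ : ℂ) (Fintype.card H : ℂ), smul_smul (l _ : ℂ), ← Units.val_mul, ← map_mul]
        have h1 : (⟨g⁻¹, H.inv_mem hg⟩ : H) * ⟨g, hg⟩ = 1 := Subtype.ext (inv_mul_cancel g)
        rw [h1, map_one, Units.val_one, one_smul]
      · simp only [P]
        rw [isotypicSum_apply_of_notMem hl he (fun h => hg (by simpa using H.inv_mem h)), map_zero]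
    simp only [Z, LinearMap.sum_apply, hterm, Finset.sum_ite, Finset.sum_const_zero, add_zero,
      Finset.sum_const]
    rw [mul_smul, ← Nat.cast_smul_eq_nsmul ℂ, Fintype.card_subtype]
  have hZ : ∀ w, Z w = ((Fintype.card H : ℂ) * (Fintype.card H : ℂ)) • w := by
    intro w
    have hw : w ∈ Submodule.span ℂ (Set.range fun g => τ g e) := hspan ▸ Submodule.mem_top
    induction hw using Submodule.span_induction with
    | mem x hx => obtain ⟨g, rfl⟩ := hx; simp only [hZcomm, hZe, map_smul]
    | zero => simp
    | add x y _ _ hx hy => rw [map_add, hx, hy, smul_add]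
    | smul c x _ hx => rw [map_smul, hx, smul_comm]
  refine { exists_pair_ne := ⟨⊥, ⊤, fun h => he0 ?_⟩, eq_bot_or_eq_top := fun M => ?_ }
  · have : (⊥ : Submodule ℂ W) = ⊤ := congrArg Subrepresentation.toSubmodule h
    exact (Submodule.mem_bot ℂ).1 (this ▸ Submodule.mem_top)
  · have hPM : ∀ m ∈ M.toSubmodule, P m ∈ M.toSubmodule := by
      intro m hm
      simp only [P, isotypicSum, LinearMap.sum_apply, LinearMap.smul_apply]
      exact Submodule.sum_mem _ fun h _ => Submodule.smul_mem _ _ (M.apply_mem_toSubmodule _ hm)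
    by_cases h0 : ∀ m ∈ M.toSubmodule, P m = 0
    · left
      apply Subrepresentation.toSubmodule_injective
      change M.toSubmodule = ⊥
      rw [Submodule.eq_bot_iff]
      intro m hm
      have hz : Z m = 0 := by
        simp only [Z, LinearMap.sum_apply, LinearMap.comp_apply]
        refine Finset.sum_eq_zero fun g _ => ?_
        rw [h0 _ (M.apply_mem_toSubmodule _ hm), map_zero]
      rw [hZ] at hz
      exact (smul_eq_zero.1 hz).resolve_left (mul_ne_zero hcard hcard)
    · right
      push Not at h0
      obtain ⟨m, hm, hPm⟩ := h0
      obtain ⟨c, hc⟩ := Submodule.mem_span_singleton.1 (hPspan m)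
      have hc0 : c ≠ 0 := by
        rintro rfl
        exact hPm (by rw [← hc, zero_smul])
      have heM : e ∈ M.toSubmodule := by
        have := Submodule.smul_mem _ c⁻¹ (hPM m hm)
        rwa [← hc, smul_smul, inv_mul_cancel₀ hc0, one_smul] at this
      apply Subrepresentation.toSubmodule_injective
      change M.toSubmodule = ⊤
      rw [eq_top_iff, ← hspan, Submodule.span_le]
      rintro _ ⟨g, rfl⟩
      exact M.apply_mem_toSubmodule g heM

end Irreducibility

/-! ### Existence and uniqueness of the rational irreducible containing a given character. -/

section RationalRepresentations

variable {G : Type} [Group G] {H : Subgroup G}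

theorem HasEigenvectorFor.map {W W' : Type} [AddCommGroup W] [Module ℂ W] [AddCommGroup W']
    [Module ℂ W'] {l : H →* ℂˣ} {τ : Representation ℂ G W} {τ' : Representation ℂ G W'}
    (f : W →ₗ[ℂ] W') (hf : Function.Injective f) (hfτ : ∀ g w, f (τ g w) = τ' g (f w))
    (h : HasEigenvectorFor l τ) : HasEigenvectorFor l τ' := by
  obtain ⟨v, hv0, hv⟩ := h
  exact ⟨f v, fun h => hv0 (hf (by rw [h, map_zero])), fun h => by rw [← hfτ, hv, map_smul]⟩

theorem hasEigenvectorFor_leftRegular [Finite G] (l : H →* ℂˣ) :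
    HasEigenvectorFor l (complexify (Representation.leftRegular ℚ G)) := by
  classical
  have := Fintype.ofFinite G
  refine ⟨isotypicSum l _ (1 ⊗ₜ MonoidAlgebra.single 1 1), fun h => ?_, fun h => apply_isotypicSum h _⟩
  -- The coefficient at the identity, to which only the term `h = 1` contributes, with value `1`.
  let φ : MonoidAlgebra ℚ G →ₗ[ℚ] ℚ :=
    Finsupp.lapply 1 ∘ₗ (MonoidAlgebra.coeffLinearEquiv ℚ).toLinearMap
  have h1 := congrArg (TensorProduct.rid ℚ ℂ) (congrArg (φ.baseChange ℂ) h)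
  simp only [isotypicSum, LinearMap.sum_apply, LinearMap.smul_apply, complexify_tmul, map_sum,
    map_smul, LinearMap.baseChange_tmul, map_zero] at h1
  have hφ : ∀ x : H, φ (Representation.leftRegular ℚ G (x : G) (MonoidAlgebra.single 1 1)) =
      if x = 1 then 1 else 0 := by
    intro x
    simp [φ, Finsupp.single_apply]
  simp only [hφ, TensorProduct.smul_tmul', TensorProduct.rid_tmul] at h1
  simp at h1

/-- Every linear character of a subgroup occurs in the restriction of the complexification of some
irreducible rational representation. -/
theorem exists_irrep_hasEigenvectorFor [Finite G] (l : H →* ℂˣ) :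
    ∃ ρ : Irrep ℚ G, HasEigenvectorFor l (complexify ρ.rep) := by
  -- Induction on dimension: for a proper nonzero subrepresentation `M`, the eigenvector either
  -- survives in the quotient by `M` or, by exactness, comes from `M`.
  have key : ∀ n : ℕ, ∀ (V : Type) [AddCommGroup V] [Module ℚ V] [FiniteDimensional ℚ V]
      (ρ : Representation ℚ G V), Module.finrank ℚ V = n → HasEigenvectorFor l (complexify ρ) →
      ∃ ρ : Irrep ℚ G, HasEigenvectorFor l (complexify ρ.rep) := by
    intro n
    induction n using Nat.strong_induction_on with
    | _ n ih =>
    intro V _ _ _ ρ hn hρ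
    by_cases hirr : ρ.IsIrreducible
    · exact ⟨⟨V, ρ, hirr⟩, hρ⟩
    obtain ⟨v, hv0, hv⟩ := hρ
    have hV : Nontrivial V := by
      by_contra hV
      rw [not_nontrivial_iff_subsingleton] at hV
      exact hv0 (Subsingleton.elim _ _)
    have : ∃ M : Subrepresentation ρ, M.toSubmodule ≠ ⊥ ∧ M.toSubmodule ≠ ⊤ := by
      by_contra hM
      push Not at hM
      refine hirr { exists_pair_ne := ⟨⊥, ⊤, fun h => bot_ne_top (α := Submodule ℚ V)
        (congrArg Subrepresentation.toSubmodule h)⟩, eq_bot_or_eq_top := fun M => ?_ }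
      by_cases h : M.toSubmodule = ⊥
      · exact Or.inl (Subrepresentation.toSubmodule_injective h)
      · exact Or.inr (Subrepresentation.toSubmodule_injective (hM M h))
    obtain ⟨M, hMbot, hMtop⟩ := this
    have hle : ∀ g, M.toSubmodule ≤ M.toSubmodule.comap (ρ g) := fun g _ hx =>
      M.apply_mem_toSubmodule g hx
    let q : V →ₗ[ℚ] V ⧸ M.toSubmodule := M.toSubmodule.mkQ
    by_cases hqv : q.baseChange ℂ v = 0
    · refine ih _ (hn ▸ Submodule.finrank_lt hMtop) M.toSubmodule M.toRepresentation rfl ?_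
      have hex := lTensor_exact ℂ (f := M.toSubmodule.subtype) (g := q)
        (by rw [LinearMap.exact_iff]; simp [q]) (Submodule.mkQ_surjective _)
      obtain ⟨u, hu⟩ := (hex v).1 hqv
      have hinj := injective_baseChange (Submodule.subtype_injective M.toSubmodule)
      have hu' : M.toSubmodule.subtype.baseChange ℂ u = v := hu
      refine ⟨u, fun h => hv0 (by rw [← hu', h, map_zero]), fun h => hinj ?_⟩
      rw [baseChange_complexify (σ := ρ) M.toSubmodule.subtype (fun _ _ => rfl), hu', hv, map_smul, hu']
    · refine ih _ ?_ (V ⧸ M.toSubmodule) (ρ.quotient M.toSubmodule hle) rfl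
        ⟨q.baseChange ℂ v, hqv, fun h => ?_⟩
      · have := Submodule.finrank_quotient_add_finrank M.toSubmodule
        have h2 := Submodule.one_le_finrank_iff.2 hMbot
        omega
      · rw [← baseChange_complexify (ρ := ρ) q (fun _ _ => rfl), hv, map_smul]
  have := Fintype.ofFinite G
  have : FiniteDimensional ℚ (MonoidAlgebra ℚ G) :=
    Module.Finite.equiv (MonoidAlgebra.coeffLinearEquiv ℚ).symm
  exact key _ _ _ rfl (hasEigenvectorFor_leftRegular l)

/-- If there is a nonzero complex intertwiner between complexifications then there is a nonzero
rational one. -/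
theorem exists_intertwiningMap_of_complexify {V V' : Type} [AddCommGroup V] [Module ℚ V]
    [AddCommGroup V'] [Module ℚ V'] {ρ : Representation ℚ G V} {σ : Representation ℚ G V'}
    (T : ℂ ⊗[ℚ] V →ₗ[ℂ] ℂ ⊗[ℚ] V') (hT : ∀ g x, T (complexify ρ g x) = complexify σ g (T x))
    (hT0 : T ≠ 0) : ∃ f : ρ.IntertwiningMap σ, f ≠ 0 := by
  -- Each rational functional on `ℂ` extracts a rational intertwiner `v ↦ (φ ⊗ 1) (T (1 ⊗ v))`. Such
  -- functionals separate points of `ℂ ⊗ V'` coordinate by coordinate, so they cannot all give zero.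
  let F (φ : ℂ →ₗ[ℚ] ℚ) : ρ.IntertwiningMap σ :=
    { toLinearMap := (TensorProduct.lid ℚ V').toLinearMap ∘ₗ φ.rTensor V' ∘ₗ
        T.restrictScalars ℚ ∘ₗ TensorProduct.mk ℚ ℂ V 1
      isIntertwining' := by
        intro g
        ext v
        simp only [LinearMap.comp_apply, TensorProduct.mk_apply, LinearMap.restrictScalars_apply]
        rw [← complexify_tmul, hT]
        generalize T (1 ⊗ₜ v) = y
        induction y using TensorProduct.induction_on with
        | zero => simp
        | tmul c w => simp [complexify_tmul]
        | add x y hx hy => simp only [map_add, hx, hy] }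
  by_contra! h
  refine hT0 (TensorProduct.AlgebraTensorModule.curry_injective ?_)
  ext v
  simp only [TensorProduct.AlgebraTensorModule.curry_apply, TensorProduct.curry_apply,
    LinearMap.restrictScalars_apply, LinearMap.zero_apply]
  let b := Module.Free.chooseBasis ℚ V'
  have hb : ∀ y : ℂ ⊗[ℚ] V', (∀ φ : ℂ →ₗ[ℚ] ℚ, TensorProduct.lid ℚ V' (φ.rTensor V' y) = 0) →
      y = 0 := by
    classical
    intro y hy
    refine (b.baseChange ℂ).repr.map_eq_zero_iff.1 (Finsupp.ext fun i => ?_)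
    refine (Module.forall_dual_apply_eq_zero_iff ℚ _).1 fun φ => ?_
    have h1 : ∀ y : ℂ ⊗[ℚ] V', φ ((b.baseChange ℂ).repr y i) =
        b.repr (TensorProduct.lid ℚ V' (φ.rTensor V' y)) i := by
      intro y
      induction y using TensorProduct.induction_on with
      | zero => simp
      | tmul c w => simp [mul_comm]
      | add x y hx hy => simp only [map_add, Finsupp.add_apply, hx, hy]
    rw [h1, hy, map_zero, Finsupp.zero_apply]
  exact hb _ fun φ => LinearMap.congr_fun
    (congrArg Representation.IntertwiningMap.toLinearMap (h (F φ))) v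

/-- Averaging the rank-one map `x ↦ μ x • w` over `G` gives an intertwiner. In its value at `v` only
the terms from `H` survive, by Mackey's criterion, and they add up to `|H| ^ 2 * φ v` times `w`.
Descent to `ℚ` and Schur's lemma finish. -/
theorem irrep_equiv_of_hasEigenvectorFor [Finite G] {l : H →* ℂˣ} (hl : MackeyCriterion l)
    (ρ σ : Irrep ℚ G) (hρ : HasEigenvectorFor l (complexify ρ.rep))
    (hσ : HasEigenvectorFor l (complexify σ.rep)) : ρ ≈ σ := by
  classical
  have := Fintype.ofFinite G
  obtain ⟨v, hv0, hv⟩ := hρ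
  obtain ⟨w, hw0, hw⟩ := hσ
  have hcard : (Fintype.card H : ℂ) ≠ 0 := by simp
  obtain ⟨φ, hφ⟩ : ∃ φ : Module.Dual ℂ (ℂ ⊗[ℚ] ρ.V), φ v ≠ 0 := by
    by_contra! h
    exact hv0 ((Module.forall_dual_apply_eq_zero_iff ℂ v).1 h)
  let μ : Module.Dual ℂ (ℂ ⊗[ℚ] ρ.V) := φ ∘ₗ isotypicSum l (complexify ρ.rep)
  let T : ℂ ⊗[ℚ] ρ.V →ₗ[ℂ] ℂ ⊗[ℚ] σ.V :=
    ∑ g : G, (μ ∘ₗ complexify ρ.rep g⁻¹).smulRight (complexify σ.rep g w)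
  have hT : ∀ k x, T (complexify ρ.rep k x) = complexify σ.rep k (T x) := by
    intro k x
    simp only [T, LinearMap.sum_apply, map_sum, LinearMap.smulRight_apply, LinearMap.comp_apply,
      map_smul]
    refine Fintype.sum_equiv (Equiv.mulLeft k⁻¹) _ _ fun g => ?_
    rw [Equiv.coe_mulLeft, ← Module.End.mul_apply, ← map_mul, ← Module.End.mul_apply, ← map_mul,
      mul_inv_cancel_left, mul_inv_rev, inv_inv]
  have hTv : T v = ((Fintype.card H : ℂ) * (Fintype.card H : ℂ) * φ v) • w := by
    have hterm : ∀ g : G, ((μ ∘ₗ complexify ρ.rep g⁻¹).smulRight (complexify σ.rep g w)) v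
        = if g ∈ H then ((Fintype.card H : ℂ) * φ v) • w else 0 := by
      intro g
      simp only [LinearMap.smulRight_apply, LinearMap.comp_apply, μ]
      split_ifs with hg
      · have h1 := hv ⟨g⁻¹, H.inv_mem hg⟩
        simp only at h1
        have h2 := hw ⟨g, hg⟩
        simp only at h2
        rw [h1, h2, map_smul, isotypicSum_of_eigenvector hv, map_smul, map_smul, smul_smul]
        congr 1
        have h3 : ((l ⟨g⁻¹, H.inv_mem hg⟩ : ℂˣ) : ℂ) * (l ⟨g, hg⟩ : ℂˣ) = 1 := by
          rw [← Units.val_mul, ← map_mul]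
          have h1 : (⟨g⁻¹, H.inv_mem hg⟩ : H) * ⟨g, hg⟩ = 1 := Subtype.ext (inv_mul_cancel g)
          rw [h1, map_one, Units.val_one]
        simp only [smul_eq_mul]
        linear_combination (Fintype.card H : ℂ) * φ v * h3
      · rw [isotypicSum_apply_of_notMem hl hv (fun h => hg (by simpa using H.inv_mem h)), map_zero,
          zero_smul]
    simp only [T, LinearMap.sum_apply, hterm, Finset.sum_ite, Finset.sum_const_zero, add_zero,
      Finset.sum_const]
    rw [← Nat.cast_smul_eq_nsmul ℂ, smul_smul, mul_assoc, Fintype.card_subtype]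
  obtain ⟨f, hf⟩ := exists_intertwiningMap_of_complexify T hT (fun h => by
    rw [h, LinearMap.zero_apply] at hTv
    exact smul_ne_zero (mul_ne_zero (mul_ne_zero hcard hcard) hφ) hw0 hTv.symm)
  have := ρ.irreducible
  have := σ.irreducible
  exact ⟨f.ofBijective ((Representation.IsIrreducible.bijective_or_eq_zero f).resolve_right hf)⟩

theorem HasEigenvectorFor.of_equiv {l : H →* ℂˣ} {ρ σ : Irrep ℚ G} (h : ρ ≈ σ)
    (hρ : HasEigenvectorFor l (complexify ρ.rep)) : HasEigenvectorFor l (complexify σ.rep) := by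
  obtain ⟨e⟩ := h
  exact hρ.map (e.toLinearEquiv.toLinearMap.baseChange ℂ)
    (injective_baseChange e.toLinearEquiv.injective)
    (baseChange_complexify _ fun g v =>
      Representation.IntertwiningMap.isIntertwining _ _ e.toIntertwiningMap g v)

end RationalRepresentations

/-! ### Induced representations and Frobenius reciprocity. -/

section Constituents

variable {G : Type} [Group G] {H : Subgroup G} {W : Type} [AddCommGroup W] [Module ℂ W]

theorem linearRep_apply (χ : G →* ℂˣ) (g : G) (z : ℂ) : linearRep χ g z = (χ g : ℂ) * z := rfl

theorem isIrreducible_linearRep (χ : G →* ℂˣ) : (linearRep χ).IsIrreducible where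
  exists_pair_ne := ⟨⊥, ⊤, fun h => bot_ne_top (α := Submodule ℂ ℂ)
    (congrArg Subrepresentation.toSubmodule h)⟩
  eq_bot_or_eq_top M := (eq_bot_or_eq_top M.toSubmodule).imp
    (fun h => Subrepresentation.toSubmodule_injective h)
    (fun h => Subrepresentation.toSubmodule_injective h)

theorem isConstituent_linearRep_iff (χ : G →* ℂˣ) (τ : Representation ℂ G W) :
    IsConstituent (linearRep χ) τ ↔ ∃ v : W, v ≠ 0 ∧ ∀ g, τ g v = (χ g : ℂ) • v := by
  constructor
  · rintro ⟨-, f, hf⟩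
    refine ⟨f 1, fun h => one_ne_zero (hf (h.trans (map_zero f).symm)), fun g => ?_⟩
    rw [← f.isIntertwining, linearRep_apply, ← smul_eq_mul, map_smul]
  · rintro ⟨v, hv0, hv⟩
    refine ⟨isIrreducible_linearRep χ, ⟨LinearMap.toSpanSingleton ℂ W v, fun g => ?_⟩, ?_⟩
    · ext
      simp [linearRep_apply, hv]
    · exact smul_left_injective ℂ hv0

/-- The canonical generator of an induced degree-one representation. -/
noncomputable def indGenerator (l : H →* ℂˣ) :
    Representation.IndV H.subtype (linearRep l) :=
  Representation.IndV.mk H.subtype (linearRep l) 1 1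

theorem ind_apply_indGenerator (l : H →* ℂˣ) (g : G) :
    (linearRep l).ind H.subtype g (indGenerator l) =
      Representation.IndV.mk H.subtype (linearRep l) g⁻¹ 1 := by
  rw [indGenerator, Representation.ind_mk, one_mul]

theorem indGenerator_eigenvector (l : H →* ℂˣ) (h : H) :
    (linearRep l).ind H.subtype h (indGenerator l) = (l h : ℂ) • indGenerator l := by
  rw [ind_apply_indGenerator, indGenerator, ← map_smul]
  have h1 := (Representation.Coinvariants.mk_inv_tmul ((Representation.leftRegular ℂ G).comp H.subtype)
    (linearRep l) (MonoidAlgebra.single 1 1) (1 : ℂ) h)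
  simpa [linearRep_apply] using h1

theorem span_indGenerator (l : H →* ℂˣ) :
    Submodule.span ℂ (Set.range fun g => (linearRep l).ind H.subtype g (indGenerator l)) = ⊤ := by
  set S := Submodule.span ℂ (Set.range fun g => (linearRep l).ind H.subtype g (indGenerator l))
  rw [← S.ker_mkQ, LinearMap.ker_eq_top]
  refine Representation.IndV.hom_ext _ _ fun g => LinearMap.ext_ring ?_
  rw [LinearMap.comp_apply, LinearMap.zero_comp, LinearMap.zero_apply, Submodule.mkQ_apply,
    Submodule.Quotient.mk_eq_zero]
  refine Submodule.subset_span ⟨g⁻¹, ?_⟩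
  simp only
  rw [ind_apply_indGenerator, inv_inv]

/-- Frobenius reciprocity for an induced degree-one representation. -/
theorem exists_intertwiningMap_ind (l : H →* ℂˣ) {τ : Representation ℂ G W} {v : W}
    (hv : ∀ h : H, τ h v = (l h : ℂ) • v) :
    ∃ f : ((linearRep l).ind H.subtype).IntertwiningMap τ, f (indGenerator l) = v := by
  -- In `IndV` the class of `g ⊗ 1` is the translate of the generator by `g⁻¹`, which forces its
  -- image to be `τ g⁻¹ v`.
  let F : TensorProduct ℂ (MonoidAlgebra ℂ G) ℂ →ₗ[ℂ] W :=
    TensorProduct.lift ((Finsupp.lift _ ℂ G fun g => LinearMap.toSpanSingleton ℂ W (τ g⁻¹ v)) ∘ₗ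
      (MonoidAlgebra.coeffLinearEquiv ℂ).toLinearMap)
  let f : Representation.IndV H.subtype (linearRep l) →ₗ[ℂ] W :=
    Representation.Coinvariants.lift _ F fun h => by
      ext g
      simp [F, linearRep_apply, mul_inv_rev, Representation.ofMulAction_single, map_mul]
      rw [← Subgroup.coe_inv, hv, map_smul, smul_smul, ← Units.val_mul, ← map_mul, mul_inv_cancel,
        map_one, Units.val_one, one_smul]
  have hf : ∀ g, f (Representation.IndV.mk _ _ g 1) = τ g⁻¹ v := fun g => by simp [f, F]
  refine ⟨⟨f, fun g => ?_⟩, ?_⟩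
  · refine Representation.IndV.hom_ext _ _ fun x => LinearMap.ext_ring ?_
    change f ((linearRep l).ind H.subtype g (Representation.IndV.mk H.subtype (linearRep l) x 1)) =
      τ g (f (Representation.IndV.mk H.subtype (linearRep l) x 1))
    rw [Representation.ind_mk, hf, hf, mul_inv_rev, inv_inv, map_mul, Module.End.mul_apply]
  · exact (hf 1).trans (by simp)

/-- Frobenius reciprocity sends the generator to a nonzero eigenvector of the regular
representation. -/
theorem indGenerator_ne_zero [Finite G] (l : H →* ℂˣ) : indGenerator l ≠ 0 := by
  obtain ⟨v, hv0, hv⟩ := hasEigenvectorFor_leftRegular l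
  obtain ⟨f, hf⟩ := exists_intertwiningMap_ind l hv
  intro h
  rw [h, map_zero] at hf
  exact hv0 hf.symm

theorem isIrreducible_ind [Finite G] {l : H →* ℂˣ} (hl : MackeyCriterion l) :
    ((linearRep l).ind H.subtype).IsIrreducible :=
  isIrreducible_of_span_eigenvector hl (indGenerator_ne_zero l) (indGenerator_eigenvector l)
    (span_indGenerator l)

theorem isConstituent_ind_iff [Finite G] {l : H →* ℂˣ} (hl : MackeyCriterion l)
    (τ : Representation ℂ G W) :
    IsConstituent ((linearRep l).ind H.subtype) τ ↔ HasEigenvectorFor l τ := by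
  constructor
  · rintro ⟨-, f, hf⟩
    exact HasEigenvectorFor.map f.toLinearMap hf f.isIntertwining
      ⟨_, indGenerator_ne_zero l, indGenerator_eigenvector l⟩
  · rintro ⟨v, hv0, hv⟩
    have hirr := isIrreducible_ind hl
    obtain ⟨f, hf⟩ := exists_intertwiningMap_ind l hv
    refine ⟨hirr, f, (Representation.IsIrreducible.injective_or_eq_zero f).resolve_right ?_⟩
    rintro rfl
    exact hv0 hf.symm

end Constituents

/-! ### From invariants to bijections. -/

section Labelling

/-- A labelling of the members of a family occurring in the classes of a set `S` which separates
the classes gives a bijection between `S` and the set of labels. -/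
theorem exists_equiv_of_labelling {X : Type 1} {s : Setoid X} {T Λ : Type*}
    (S : Quotient s → Prop) (R : T → X → Prop) (L : T → Λ) (hL : Function.Surjective L)
    (hexists : ∀ x, S (Quotient.mk s x) → ∃ t, R t x)
    (hlabel : ∀ x, S (Quotient.mk s x) → ∀ t t', R t x → (R t' x ↔ L t' = L t))
    (hoccurs : ∀ t, ∃ x, S (Quotient.mk s x) ∧ R t x)
    (hsep : ∀ t x y, R t x → R t y → s x y)
    (hcongr : ∀ t x y, s x y → R t x → R t y) :
    ∃ e : {π : Quotient s // S π} ≃ Λ, ∀ x (hx : S (Quotient.mk s x)) t,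
      R t x ↔ e ⟨Quotient.mk s x, hx⟩ = L t := by
  have hex : ∀ π : {π : Quotient s // S π}, ∃ t, ∃ x, Quotient.mk s x = π.1 ∧ R t x := by
    rintro ⟨π, hπ⟩
    obtain ⟨x, rfl⟩ := Quotient.exists_rep π
    obtain ⟨t, ht⟩ := hexists x hπ
    exact ⟨t, x, rfl, ht⟩
  choose t y hy hty using hex
  have key : ∀ x (hx : S (Quotient.mk s x)) t', R t' x ↔ L (t ⟨Quotient.mk s x, hx⟩) = L t' := by
    intro x hx t'
    have h1 : R (t ⟨Quotient.mk s x, hx⟩) x :=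
      hcongr _ _ _ (Quotient.exact (hy ⟨Quotient.mk s x, hx⟩)) (hty _)
    rw [hlabel x hx _ _ h1, eq_comm]
  refine ⟨Equiv.ofBijective (fun π => L (t π)) ⟨?_, fun z => ?_⟩, key⟩
  · rintro ⟨π, hπ⟩ ⟨π', hπ'⟩ h
    obtain ⟨x, rfl⟩ := Quotient.exists_rep π
    obtain ⟨x', rfl⟩ := Quotient.exists_rep π'
    exact Subtype.ext (Quotient.sound
      (hsep _ _ _ ((key x hπ (t ⟨Quotient.mk s x', hπ'⟩)).2 h) ((key x' hπ' _).2 rfl)))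
  · obtain ⟨t', rfl⟩ := hL z
    obtain ⟨x, hx, hxt⟩ := hoccurs t'
    exact ⟨⟨Quotient.mk s x, hx⟩, (key x hx t').1 hxt⟩

end Labelling

/-! ### Linear characters, their kernels and Galois conjugacy. -/

section LinearCharacters

variable {G : Type} [Group G]

/-- The values of a linear character of a finite group are the powers of one value, which is a
primitive root of unity. -/
theorem exists_generator_of_linearCharacter [Finite G] (χ : G →* ℂˣ) :
    ∃ g : G, ∃ N : ℕ, 0 < N ∧ IsPrimitiveRoot (χ g : ℂ) N ∧ ∀ h, ∃ m : ℕ, h * (g ^ m)⁻¹ ∈ χ.ker := by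
  have : Finite χ.range := Set.finite_range χ
  have : IsCyclic χ.range := isCyclic_of_injective_ringHom
    ((Units.coeHom ℂ).comp χ.range.subtype) (Units.val_injective.comp Subtype.val_injective)
  obtain ⟨⟨_, g, rfl⟩, hg⟩ := IsCyclic.exists_generator (α := χ.range)
  refine ⟨g, orderOf (χ g), orderOf_pos_iff.2 (MonoidHom.isOfFinOrder χ (isOfFinOrder_of_finite g)), ?_, fun h => ?_⟩
  · exact IsPrimitiveRoot.coe_units_iff.2 (IsPrimitiveRoot.orderOf (χ g))
  · obtain ⟨m, hm⟩ := (mem_powers_iff_mem_zpowers.2 (hg ⟨χ h, h, rfl⟩))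
    refine ⟨m, ?_⟩
    have hm' : χ g ^ m = χ h := congrArg Subtype.val hm
    rw [MonoidHom.mem_ker, map_mul, map_inv, map_pow, hm', mul_inv_cancel]

theorem apply_eq_pow_of_mem_ker {M : Type*} [Group M] {ψ : G →* M} {g h : G} {m : ℕ}
    (hm : h * (g ^ m)⁻¹ ∈ ψ.ker) : ψ h = ψ g ^ m := by
  rwa [MonoidHom.mem_ker, map_mul, map_inv, map_pow, mul_inv_eq_one] at hm

/-- The kernel determines which powers of `g` map to `1`. -/
theorem isPrimitiveRoot_of_ker_eq {χ ψ : G →* ℂˣ} (h : ψ.ker = χ.ker) {g : G} {N : ℕ}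
    (hg : IsPrimitiveRoot (χ g : ℂ) N) : IsPrimitiveRoot (ψ g : ℂ) N := by
  have hk : ∀ m : ℕ, (ψ g : ℂ) ^ m = 1 ↔ (χ g : ℂ) ^ m = 1 := by
    intro m
    rw [← Units.val_pow_eq_pow_val, ← Units.val_pow_eq_pow_val, Units.val_eq_one, Units.val_eq_one,
      ← map_pow, ← map_pow, ← MonoidHom.mem_ker, ← MonoidHom.mem_ker, h]
  exact ⟨(hk N).2 hg.pow_eq_one, fun m hm => hg.dvd_of_pow_eq_one m ((hk m).1 hm)⟩

theorem minpoly_eq_of_isPrimitiveRoot {μ ν : ℂ} {N : ℕ} (hN : 0 < N) (hμ : IsPrimitiveRoot μ N)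
    (hν : IsPrimitiveRoot ν N) : minpoly ℚ μ = minpoly ℚ ν := by
  rw [← Polynomial.cyclotomic_eq_minpoly_rat hμ hN, ← Polynomial.cyclotomic_eq_minpoly_rat hν hN]

/-- Two linear characters of a finite group are Galois conjugate if and only if they have the same
kernel. -/
theorem mem_galoisClass_iff [Finite G] (χ ψ : G →* ℂˣ) : ψ ∈ galoisClass χ ↔ ψ.ker = χ.ker := by
  constructor
  · rintro ⟨σ, hσ⟩
    ext g
    rw [MonoidHom.mem_ker, MonoidHom.mem_ker, ← Units.val_eq_one, ← Units.val_eq_one, hσ]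
    rw [OneMemClass.coe_eq_one, map_eq_one_iff _ σ.injective, ← OneMemClass.coe_eq_one]
    rfl
  · intro h
    -- It suffices to find `σ` with `χ g ↦ ψ g`. Both are primitive `N`-th roots of unity, hence
    -- conjugate, and `ℚ(χ)` is the Galois extension generated by `χ g`. All other values are powers
    -- of these.
    obtain ⟨g, N, hN, hg, hgen⟩ := exists_generator_of_linearCharacter χ
    have hψ := isPrimitiveRoot_of_ker_eq h hg
    have hfield : characterField χ = IntermediateField.adjoin ℚ {(χ g : ℂ)} := by
      apply le_antisymm
      · rw [characterField, IntermediateField.adjoin_le_iff]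
        rintro _ ⟨x, rfl⟩
        obtain ⟨m, hm⟩ := hgen x
        simp only [apply_eq_pow_of_mem_ker hm, Units.val_pow_eq_pow_val]
        exact pow_mem (IntermediateField.mem_adjoin_simple_self ℚ _) m
      · rw [IntermediateField.adjoin_simple_le_iff]
        exact IntermediateField.subset_adjoin ℚ _ ⟨g, rfl⟩
    have : NeZero N := ⟨hN.ne'⟩
    have hcyc : IsCyclotomicExtension {N} ℚ (characterField χ) := by
      have hsub : (characterField χ).toSubalgebra = Algebra.adjoin ℚ {(χ g : ℂ)} := by
        rw [hfield]
        exact IntermediateField.adjoin_simple_toSubalgebra_of_isAlgebraic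
          (hg.isIntegral hN).tower_top.isAlgebraic
      have h1 : IsCyclotomicExtension {N} ℚ (characterField χ).toSubalgebra := by
        rw [hsub]
        exact hg.adjoin_isCyclotomicExtension ℚ
      -- Two instances of the `ℚ`-algebra structure have to be identified; such a structure is
      -- unique.
      have halg : (DivisionRing.toRatAlgebra : Algebra ℚ (characterField χ)) =
        (characterField χ).toSubalgebra.algebra := Subsingleton.elim _ _
      rw [halg]
      exact h1
    have hnormal : IsGalois ℚ (characterField χ) :=
      IsCyclotomicExtension.isGalois (S := {N}) (K := ℚ) (L := characterField χ)
    obtain ⟨i, -, hi⟩ := hg.eq_pow_of_pow_eq_one hψ.pow_eq_one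
    have hval : ((characterValue χ g ^ i : characterField χ) : ℂ) = ψ g := hi
    have hconj : minpoly ℚ (characterValue χ g) = minpoly ℚ (characterValue χ g ^ i) := by
      let val : characterField χ →ₐ[ℚ] ℂ := (algebraMap (characterField χ) ℂ).toRatAlgHom
      have hinj : Function.Injective val := Subtype.val_injective
      rw [← minpoly.algHom_eq val hinj, ← minpoly.algHom_eq val hinj,
        show val (characterValue χ g ^ i) = ψ g from hval,
        show val (characterValue χ g) = χ g from rfl]
      exact minpoly_eq_of_isPrimitiveRoot hN hg hψ
    obtain ⟨σ, hσ⟩ := isConjRoot_iff_exists_algEquiv.1 hconj.symm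
    refine ⟨σ, fun x => ?_⟩
    obtain ⟨m, hm⟩ := hgen x
    have hx : characterValue χ x = characterValue χ g ^ m := by
      apply Subtype.ext
      change (χ x : ℂ) = (χ g : ℂ) ^ m
      rw [apply_eq_pow_of_mem_ker hm, Units.val_pow_eq_pow_val]
    rw [apply_eq_pow_of_mem_ker (h ▸ hm : x * (g ^ m)⁻¹ ∈ ψ.ker), hx, map_pow, hσ,
      Units.val_pow_eq_pow_val, ← hval]
    rfl

theorem galoisClass_eq_iff [Finite G] (χ ψ : G →* ℂˣ) : galoisClass χ = galoisClass ψ ↔ χ.ker = ψ.ker := by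
  have h : ∀ χ : G →* ℂˣ, galoisClass χ = {ψ | ψ.ker = χ.ker} := fun χ =>
    Set.ext fun ψ => mem_galoisClass_iff χ ψ
  constructor
  · intro hχ
    rw [← mem_galoisClass_iff, ← hχ, mem_galoisClass_iff]
  · intro hχ
    rw [h, h, hχ]

variable {V : Type} [AddCommGroup V] [Module ℚ V] {ρ : Representation ℚ G V}

open scoped commutatorElement in
theorem commute_of_commutator_le_ker (h : commutator G ≤ MonoidHom.ker ρ) (x y : G) (v : V) :
    ρ x (ρ y v) = ρ y (ρ x v) := by
  have h1 : ρ ⁅x, y⁆ = 1 := h (Subgroup.commutator_mem_commutator (Subgroup.mem_top x) (Subgroup.mem_top y))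
  have h2 : x * y = ⁅x, y⁆ * (y * x) := by simp [commutatorElement_def, mul_assoc]
  rw [← Module.End.mul_apply, ← Module.End.mul_apply, ← map_mul, ← map_mul, h2, map_mul, h1, one_mul]

/-- An irreducible rational representation with abelian image has the same kernel as any linear
character occurring in its complexification. -/
theorem ker_eq_of_isConstituent (hρ : ρ.IsIrreducible) (h : commutator G ≤ MonoidHom.ker ρ)
    {χ : G →* ℂˣ} (hχ : IsConstituent (linearRep χ) (complexify ρ)) :
    χ.ker = MonoidHom.ker ρ := by
  obtain ⟨v, hv0, hv⟩ := (isConstituent_linearRep_iff χ _).1 hχ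
  ext g
  rw [MonoidHom.mem_ker, MonoidHom.mem_ker]
  constructor
  · intro hg
    refine sub_eq_zero.1 (eq_zero_of_baseChange_apply_eq_zero hρ (ρ g - 1) (fun x w hw => ?_) hv0 ?_)
    · rw [LinearMap.sub_apply, Module.End.one_apply] at hw ⊢
      rw [commute_of_commutator_le_ker h, ← map_sub, hw, map_zero]
    · rw [LinearMap.baseChange_sub, LinearMap.sub_apply, ← complexify_apply, hv, hg]
      simp [Module.End.one_eq_id]
  · intro hg
    have h1 := hv g
    rw [complexify_apply, hg, Module.End.one_eq_id, LinearMap.baseChange_id, LinearMap.id_apply] at h1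
    refine Units.ext (smul_left_injective ℂ hv0 ?_)
    simpa using h1.symm

/-- Modulo the common kernel every element is a power of one `g`, so a character occurs as soon as
its value at `g` is an eigenvalue of `ρ g`. Equal kernels make `χ g` and `ψ g` conjugate. -/
theorem isConstituent_linearRep_iff_ker_eq [Finite G] [FiniteDimensional ℚ V] (hρ : ρ.IsIrreducible)
    (h : commutator G ≤ MonoidHom.ker ρ) {χ : G →* ℂˣ}
    (hχ : IsConstituent (linearRep χ) (complexify ρ)) (ψ : G →* ℂˣ) :
    IsConstituent (linearRep ψ) (complexify ρ) ↔ ψ.ker = χ.ker := by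
  have hker := ker_eq_of_isConstituent hρ h hχ
  refine ⟨fun hψ => by rw [hker, ker_eq_of_isConstituent hρ h hψ], fun hψ => ?_⟩
  obtain ⟨v, hv0, hv⟩ := (isConstituent_linearRep_iff χ _).1 hχ
  obtain ⟨g, N, hN, hg, hgen⟩ := exists_generator_of_linearCharacter χ
  obtain ⟨w, hw0, hw⟩ := exists_eigenvector_baseChange_of_minpoly_eq (ρ g) hv0 (hv g)
    (minpoly_eq_of_isPrimitiveRoot hN hg (isPrimitiveRoot_of_ker_eq hψ hg))
  refine (isConstituent_linearRep_iff ψ _).2 ⟨w, hw0, fun x => ?_⟩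
  obtain ⟨m, hm⟩ := hgen x
  have hρx : ρ (x * (g ^ m)⁻¹) = 1 := by
    rwa [hker] at hm
  have hx : x = x * (g ^ m)⁻¹ * g ^ m := by simp
  have hpow : ∀ m : ℕ, complexify ρ (g ^ m) w = (ψ g : ℂ) ^ m • w := by
    intro m
    induction m with
    | zero => simp
    | succ m ih =>
      rw [pow_succ, map_mul, Module.End.mul_apply, complexify_apply ρ g, hw, map_smul, ih, smul_smul,
        pow_succ']
  rw [apply_eq_pow_of_mem_ker (hψ ▸ hm : x * (g ^ m)⁻¹ ∈ ψ.ker)]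
  nth_rewrite 1 [hx]
  rw [map_mul, Module.End.mul_apply, hpow, complexify_apply, hρx, Module.End.one_eq_id,
    LinearMap.baseChange_id, LinearMap.id_apply, Units.val_pow_eq_pow_val]

/-- A linear character of `G` occurs if and only if it has an eigenvector as a character of the
subgroup `⊤`. -/
theorem isConstituent_linearRep_iff_hasEigenvectorFor {W : Type} [AddCommGroup W] [Module ℂ W]
    (χ : G →* ℂˣ) (τ : Representation ℂ G W) :
    IsConstituent (linearRep χ) τ ↔ HasEigenvectorFor (χ.comp (⊤ : Subgroup G).subtype) τ := by
  rw [isConstituent_linearRep_iff]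
  exact ⟨fun ⟨v, h0, h⟩ => ⟨v, h0, fun g => h g⟩,
    fun ⟨v, h0, h⟩ => ⟨v, h0, fun g => h ⟨g, trivial⟩⟩⟩

/-- The criterion is vacuous for `H = ⊤`, which lets linear characters of `G` use the same
uniqueness theorem as the induced representations. -/
theorem mackeyCriterion_top (l : (⊤ : Subgroup G) →* ℂˣ) : MackeyCriterion l :=
  fun _ hg => absurd trivial hg

end LinearCharacters

/-! ### Eigenvectors in stable subspaces and on lines. -/

section CommonEigenvectors

variable {W : Type} [AddCommGroup W] [Module ℂ W]

theorem exists_eigenvector_mem [FiniteDimensional ℂ W] {E : Submodule ℂ W} (hE : E ≠ ⊥) (T : Module.End ℂ W)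
    (hT : ∀ w ∈ E, T w ∈ E) : ∃ v ∈ E, v ≠ 0 ∧ ∃ μ : ℂ, T v = μ • v := by
  have := Submodule.nontrivial_iff_ne_bot.2 hE
  obtain ⟨μ, hμ⟩ := Module.End.exists_eigenvalue (T.restrict hT)
  obtain ⟨v, hv⟩ := hμ.exists_hasEigenvector
  exact ⟨v, v.2, fun h => hv.2 (Subtype.ext h), μ, congrArg Subtype.val hv.apply_eq_smul⟩

variable {G : Type} [Group G]

/-- The linear character through which `G` acts on a line. -/
theorem exists_linearCharacter_of_forall_eigenvector {τ : Representation ℂ G W} {v : W} (hv : v ≠ 0)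
    (h : ∀ g, ∃ μ : ℂ, τ g v = μ • v) : ∃ χ : G →* ℂˣ, ∀ g, τ g v = (χ g : ℂ) • v := by
  choose f hf using h
  let F : G →* ℂ :=
    { toFun := f
      map_one' := smul_left_injective ℂ hv (by simp only; rw [← hf, map_one, one_smul]; rfl)
      map_mul' := fun x y => smul_left_injective ℂ hv (by
        simp only
        rw [← hf, map_mul, Module.End.mul_apply, hf y, map_smul, hf x, smul_smul, mul_comm]) }
  exact ⟨F.toHomUnits, fun g => hf g⟩

end CommonEigenvectors

/-! ### The units modulo `2 ^ n`. -/

section UnitsTwoPow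

/-- The unit `5` modulo `2 ^ n`. -/
def unitFive (n : ℕ) : (ZMod (2 ^ n))ˣ :=
  ZMod.unitOfCoprime 5 (Nat.Coprime.pow_right n (by decide))

theorem coe_unitFive (n : ℕ) : (unitFive n : ZMod (2 ^ n)) = 5 := by
  simp [unitFive]

theorem orderOf_unitFive {n : ℕ} (hn : 2 ≤ n) : orderOf (unitFive n) = 2 ^ (n - 2) := by
  obtain ⟨m, rfl⟩ := Nat.exists_eq_add_of_le' hn
  rw [← orderOf_units, coe_unitFive, ZMod.orderOf_five, Nat.add_sub_cancel]

theorem unitsMap_unitFive {k n : ℕ} (hkn : k ≤ n) :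
    ZMod.unitsMap (pow_dvd_pow 2 hkn) (unitFive n) = unitFive k := by
  ext
  rw [ZMod.unitsMap_val, coe_unitFive, coe_unitFive]
  exact map_ofNat (ZMod.castHom (pow_dvd_pow 2 hkn) (ZMod (2 ^ k))) 5

/-- For `2 ≤ k ≤ n` the units modulo `2 ^ n` congruent to `1` modulo `2 ^ k` are the powers of
`5 ^ 2 ^ (k - 2)`. -/
theorem ker_unitsMap_two_pow {k n : ℕ} (hk : 2 ≤ k) (hkn : k ≤ n) :
    (ZMod.unitsMap (pow_dvd_pow 2 hkn)).ker = Subgroup.zpowers (unitFive n ^ 2 ^ (k - 2)) := by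
  symm
  have hle : Subgroup.zpowers (unitFive n ^ 2 ^ (k - 2)) ≤
      (ZMod.unitsMap (pow_dvd_pow 2 hkn)).ker := by
    rw [Subgroup.zpowers_le, MonoidHom.mem_ker, map_pow, unitsMap_unitFive hkn, ← orderOf_unitFive hk,
      pow_orderOf_eq_one]
  -- Counting gives the other inclusion: reduction is surjective, so its kernel has order `φ(2 ^ n)
  -- / φ(2 ^ k) = 2 ^ (n - k)`, which is the order of `5 ^ 2 ^ (k - 2)`.
  refine Subgroup.eq_of_le_of_card_ge hle ?_
  have h1 : orderOf (unitFive n ^ 2 ^ (k - 2)) = 2 ^ (n - k) := by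
    rw [orderOf_pow' _ (by positivity), orderOf_unitFive (hk.trans hkn),
      Nat.gcd_eq_right (pow_dvd_pow 2 (by omega)), Nat.pow_div (by omega) (by norm_num)]
    congr 1
    omega
  have h2 := Subgroup.card_mul_index (ZMod.unitsMap (pow_dvd_pow 2 hkn) : (ZMod (2 ^ n))ˣ →* _).ker
  rw [Subgroup.index_ker, MonoidHom.range_eq_top.2 (ZMod.unitsMap_surjective _), Subgroup.card_top,
    Nat.card_eq_fintype_card (α := (ZMod (2 ^ k))ˣ), Nat.card_eq_fintype_card (α := (ZMod (2 ^ n))ˣ),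
    ZMod.card_units_eq_totient, ZMod.card_units_eq_totient,
    Nat.totient_prime_pow Nat.prime_two (by omega), Nat.totient_prime_pow Nat.prime_two (by omega)] at h2
  rw [Nat.card_zpowers, h1]
  have h3 : 2 ^ (n - 1) = 2 ^ (n - k) * 2 ^ (k - 1) := by
    rw [← pow_add]
    congr 1
    omega
  rw [show 2 - 1 = 1 from rfl, mul_one, mul_one, h3] at h2
  exact (Nat.eq_of_mul_eq_mul_right (by positivity) h2).le

theorem mem_ker_unitsMap_iff {k n : ℕ} (hkn : k ≤ n) (u : (ZMod (2 ^ n))ˣ) :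
    u ∈ (ZMod.unitsMap (pow_dvd_pow 2 hkn)).ker ↔ (u : ZMod (2 ^ n)).val ≡ 1 [MOD 2 ^ k] := by
  rw [MonoidHom.mem_ker, ← (ZMod.natCast_eq_natCast_iff _ _ _), ZMod.natCast_val, Units.ext_iff,
    ZMod.unitsMap_val, Nat.cast_one, Units.val_one]

/-- This computes the stabiliser, under the action of the units, of a character of `⟨a⟩` with value
`ζ` at `a`. -/
theorem pow_val_units_eq_iff {k n : ℕ} (hkn : k ≤ n) {ζ : ℂˣ} (hζ : orderOf ζ = 2 ^ k)
    (u : (ZMod (2 ^ n))ˣ) :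
    ζ ^ (u : ZMod (2 ^ n)).val = ζ ↔ u ∈ (ZMod.unitsMap (pow_dvd_pow 2 hkn)).ker := by
  rw [mem_ker_unitsMap_iff hkn, ← hζ, ← pow_eq_pow_iff_modEq, pow_one]

/-- The powers of `5` are the units congruent to `1` modulo `4`, and every unit is `1` or `-1`
modulo `4`. -/
theorem mem_zpowers_unitFive_or_neg {n : ℕ} (hn : 2 ≤ n) (u : (ZMod (2 ^ n))ˣ) :
    u ∈ Subgroup.zpowers (unitFive n) ∨ -u ∈ Subgroup.zpowers (unitFive n) := by
  have h := ker_unitsMap_two_pow le_rfl hn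
  rw [Nat.sub_self, pow_zero, pow_one] at h
  rw [← h, MonoidHom.mem_ker, MonoidHom.mem_ker]
  have h4 : ∀ v : (ZMod (2 ^ 2))ˣ, v = 1 ∨ -v = 1 := by decide
  have hneg : ZMod.unitsMap (pow_dvd_pow 2 hn) (-u) = -ZMod.unitsMap (pow_dvd_pow 2 hn) u := by
    simp [ZMod.unitsMap, Units.map_neg]
  rw [hneg]
  exact h4 _

theorem neg_one_notMem_zpowers_unitFive {n : ℕ} (hn : 2 ≤ n) :
    (-1 : (ZMod (2 ^ n))ˣ) ∉ Subgroup.zpowers (unitFive n) := by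
  have h := ker_unitsMap_two_pow le_rfl hn
  rw [Nat.sub_self, pow_zero, pow_one] at h
  rw [← h, MonoidHom.mem_ker]
  have hneg : ZMod.unitsMap (pow_dvd_pow 2 hn) (-1) = -1 := by
    simp [ZMod.unitsMap, Units.map_neg]
  rw [hneg]
  decide

/-- A character of the units modulo `2 ^ n` with prescribed values at `5` and `-1`. -/
theorem exists_character_units {n : ℕ} (hn : 2 ≤ n) {ε ω : ℂˣ} (hε : ε ^ 2 = 1)
    (hω : ω ^ 2 ^ (n - 2) = 1) :
    ∃ θ : (ZMod (2 ^ n))ˣ →* ℂˣ, θ (unitFive n) = ω ∧ θ (-1) = ε := by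
  have hsign : ∃ s : (ZMod (2 ^ 2))ˣ →* ℂˣ, s (-1) = ε := by
    have hgen : ∀ x : (ZMod (2 ^ 2))ˣ, x ∈ Subgroup.zpowers (-1) := by
      intro x
      have h4 : ∀ v : (ZMod (2 ^ 2))ˣ, v = (-1) ^ 2 ∨ v = (-1) ^ 1 := by decide
      rcases h4 x with h | h <;> rw [h] <;> exact Subgroup.npow_mem_zpowers _ _
    have hord : orderOf (-1 : (ZMod (2 ^ 2))ˣ) = 2 := orderOf_eq_prime (by decide) (by decide)
    exact ⟨monoidHomOfForallMemZpowers hgen (by rw [hord]; exact orderOf_dvd_of_pow_eq_one hε),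
      monoidHomOfForallMemZpowers_apply_gen _ _⟩
  obtain ⟨s, hs⟩ := hsign
  let N : Subgroup (ZMod (2 ^ n))ˣ := Subgroup.zpowers (-1)
  have hN : ∀ x, x ∈ N ↔ x = 1 ∨ x = -1 := by
    intro x
    constructor
    · rintro ⟨j, rfl⟩
      rcases Int.even_or_odd j with h | h
      · exact Or.inl h.neg_one_zpow
      · exact Or.inr h.neg_one_zpow
    · rintro (rfl | rfl)
      · exact N.one_mem
      · exact Subgroup.mem_zpowers _
  have hgen : ∀ x : (ZMod (2 ^ n))ˣ ⧸ N, x ∈ Subgroup.zpowers (QuotientGroup.mk' N (unitFive n)) := by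
    intro x
    obtain ⟨u, rfl⟩ := QuotientGroup.mk'_surjective N x
    rcases mem_zpowers_unitFive_or_neg hn u with h | h
    · obtain ⟨j, rfl⟩ := h
      exact ⟨j, rfl⟩
    · obtain ⟨j, hj⟩ := h
      refine ⟨j, ?_⟩
      simp only at hj ⊢
      rw [show QuotientGroup.mk' N (unitFive n) ^ j = QuotientGroup.mk' N (unitFive n ^ j) from rfl, hj,
        QuotientGroup.mk'_eq_mk']
      exact ⟨-1, (hN _).2 (Or.inr rfl), by simp⟩
  -- The order of `5` does not drop modulo `{1, -1}`, because `-1` is not a power of `5`.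
  have hord : orderOf ω ∣ orderOf (QuotientGroup.mk' N (unitFive n)) := by
    refine (orderOf_dvd_of_pow_eq_one hω).trans ?_
    rw [← orderOf_unitFive hn]
    refine orderOf_dvd_of_pow_eq_one ?_
    have h1 := pow_orderOf_eq_one (QuotientGroup.mk' N (unitFive n))
    rw [← map_pow, QuotientGroup.mk'_apply, QuotientGroup.eq_one_iff, hN] at h1
    refine h1.resolve_right fun h => neg_one_notMem_zpowers_unitFive hn ?_
    rw [← h]
    exact Subgroup.npow_mem_zpowers _ _
  let t := monoidHomOfForallMemZpowers hgen hord
  have ht : t (QuotientGroup.mk' N (unitFive n)) = ω := monoidHomOfForallMemZpowers_apply_gen _ _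
  have hneg : ZMod.unitsMap (pow_dvd_pow 2 hn) (-1) = -1 := by
    simp [ZMod.unitsMap, Units.map_neg]
  have hfive : ZMod.unitsMap (pow_dvd_pow 2 hn) (unitFive n) = 1 := by
    rw [unitsMap_unitFive hn]
    decide
  -- The first factor is `ω` at `5` and trivial at `-1`; the second depends only on the residue
  -- modulo `4`, so it is trivial at `5` and `ε` at `-1`.
  refine ⟨t.comp (QuotientGroup.mk' N) * s.comp (ZMod.unitsMap (pow_dvd_pow 2 hn)), ?_, ?_⟩
  · rw [MonoidHom.mul_apply, MonoidHom.comp_apply, MonoidHom.comp_apply, ht, hfive, map_one, mul_one]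
  · have h1 : QuotientGroup.mk' N (-1) = 1 := (QuotientGroup.eq_one_iff _).2 ((hN _).2 (Or.inr rfl))
    rw [MonoidHom.mul_apply, MonoidHom.comp_apply, MonoidHom.comp_apply, h1, hneg, hs, map_one,
      one_mul]

end UnitsTwoPow

/-! ### Structure of the holomorph and characters of the stabilisers. -/

namespace HolTwoPow

variable (n : ℕ)

instance finite_holTwoPow : Finite (HolTwoPow n) := by
  have : Finite (MulAut (Multiplicative (ZMod (2 ^ n)))) :=
    Finite.of_injective (fun f => (f : Multiplicative (ZMod (2 ^ n)) → Multiplicative (ZMod (2 ^ n))))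
      DFunLike.coe_injective
  exact Finite.of_equiv _ SemidirectProduct.equivProd.symm

/-- The unit `u` such that an automorphism of the cyclic group of order `2 ^ n` is `x ↦ x ^ u`. -/
def autUnits : MulAut (Multiplicative (ZMod (2 ^ n))) ≃* (ZMod (2 ^ n))ˣ :=
  (MulAutMultiplicative (ZMod (2 ^ n))).trans (ZMod.AddAutEquivUnits (2 ^ n)).toMultiplicative

variable {n}

theorem coe_autUnits (f : MulAut (Multiplicative (ZMod (2 ^ n)))) :
    (autUnits n f : ZMod (2 ^ n)) = (f (Multiplicative.ofAdd 1)).toAdd := rfl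

theorem ofAdd_eq_pow (x : ZMod (2 ^ n)) :
    Multiplicative.ofAdd x = Multiplicative.ofAdd (1 : ZMod (2 ^ n)) ^ x.val := by
  rw [← ofAdd_nsmul, nsmul_one, ZMod.natCast_zmod_val]

theorem autUnits_apply (f : MulAut (Multiplicative (ZMod (2 ^ n)))) (x : ZMod (2 ^ n)) :
    f (Multiplicative.ofAdd x) = Multiplicative.ofAdd ((autUnits n f : ZMod (2 ^ n)) * x) := by
  rw [ofAdd_eq_pow x, map_pow, coe_autUnits]
  apply Multiplicative.toAdd.injective
  rw [toAdd_pow, toAdd_ofAdd, nsmul_eq_mul, ZMod.natCast_zmod_val, mul_comm]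

theorem autUnits_powFive : autUnits n (powFive n) = unitFive n := by
  ext
  rw [coe_autUnits, coe_unitFive]
  change ((ZMod.unitOfCoprime 5 _ : (ZMod (2 ^ n))ˣ) : ZMod (2 ^ n)) * 1 = 5
  simp

variable (n) in
/-- The homomorphism sending an element of the holomorph to the unit by which it acts on the cyclic
group of order `2 ^ n`. -/
def unitHom : HolTwoPow n →* (ZMod (2 ^ n))ˣ :=
  (autUnits n).toMonoidHom.comp SemidirectProduct.rightHom

variable (n) in
/-- The element of the complement acting through a given unit. -/
def ofUnit : (ZMod (2 ^ n))ˣ →* HolTwoPow n :=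
  SemidirectProduct.inr.comp (autUnits n).symm.toMonoidHom

theorem unitHom_ofUnit (u : (ZMod (2 ^ n))ˣ) : unitHom n (ofUnit n u) = u := by
  simp [unitHom, ofUnit]

theorem unitHom_a : unitHom n (a n) = 1 := by
  simp [unitHom, a]

theorem b_eq : b n = ofUnit n (unitFive n)⁻¹ := by
  have : (autUnits n).symm (unitFive n)⁻¹ = (powFive n)⁻¹ := by
    rw [MulEquiv.symm_apply_eq, map_inv, autUnits_powFive]
  simp [b, ofUnit, this]

theorem unitHom_b : unitHom n (b n) = (unitFive n)⁻¹ := by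
  rw [b_eq, unitHom_ofUnit]

theorem inl_eq_pow (x : Multiplicative (ZMod (2 ^ n))) :
    (SemidirectProduct.inl x : HolTwoPow n) = a n ^ x.toAdd.val := by
  rw [a, ← map_pow, ← ofAdd_eq_pow, ofAdd_toAdd]

/-- Every element of the holomorph is a power of `a` times an element of the complement. -/
theorem eq_pow_mul_ofUnit (g : HolTwoPow n) :
    g = a n ^ g.left.toAdd.val * ofUnit n (unitHom n g) := by
  rw [← inl_eq_pow]
  conv_lhs => rw [← SemidirectProduct.inl_left_mul_inr_right g]
  simp [ofUnit, unitHom]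

theorem a_pow_two_pow : a n ^ 2 ^ n = 1 := by
  rw [a, ← map_pow, ← ofAdd_nsmul, nsmul_one, ZMod.natCast_self, ofAdd_zero, map_one]

theorem conj_a (g : HolTwoPow n) :
    g * a n * g⁻¹ = a n ^ (unitHom n g : ZMod (2 ^ n)).val := by
  have h1 : ∀ u, ofUnit n u * a n * (ofUnit n u)⁻¹ = a n ^ (u : ZMod (2 ^ n)).val := by
    intro u
    have h2 := SemidirectProduct.inl_aut (φ := MonoidHom.id (MulAut (Multiplicative (ZMod (2 ^ n)))))
      ((autUnits n).symm u) (Multiplicative.ofAdd (1 : ZMod (2 ^ n)))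
    rw [MonoidHom.id_apply, autUnits_apply, MulEquiv.apply_symm_apply, mul_one, inl_eq_pow, toAdd_ofAdd, map_inv] at h2
    exact h2.symm
  conv_lhs => rw [eq_pow_mul_ofUnit g]
  rw [mul_inv_rev, mul_assoc, mul_assoc, ← mul_assoc (ofUnit n _), ← mul_assoc (_ * _) _ (_ ^ _)⁻¹, h1,
    ← mul_assoc, ← pow_add, add_comm, pow_add, mul_inv_cancel_right]

theorem conj_a_pow (g : HolTwoPow n) (m : ℕ) :
    g * a n ^ m * g⁻¹ = (a n ^ m) ^ (unitHom n g : ZMod (2 ^ n)).val := by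
  rw [← conj_pow, conj_a, ← pow_mul, ← pow_mul, mul_comm]

/-- A root of unity `ζ` of order dividing `2 ^ n` extends to a linear character of every subgroup
which acts trivially on `ζ`, trivial on the elements of the complement. -/
theorem exists_character_extending (S : Subgroup (HolTwoPow n)) {ζ : ℂˣ} (hζ : ζ ^ 2 ^ n = 1)
    (hS : ∀ g ∈ S, ζ ^ (unitHom n g : ZMod (2 ^ n)).val = ζ) :
    ∃ l : S →* ℂˣ, ∀ g : S, l g = ζ ^ (g : HolTwoPow n).left.toAdd.val := by
  have hval : ∀ x y : ZMod (2 ^ n), ζ ^ (x + y).val = ζ ^ x.val * ζ ^ y.val := by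
    intro x y
    rw [ZMod.val_add, ← pow_add]
    exact (pow_eq_pow_mod _ hζ).symm
  have hmul : ∀ x y : ZMod (2 ^ n), ζ ^ (x * y).val = (ζ ^ x.val) ^ y.val := by
    intro x y
    rw [ZMod.val_mul, ← pow_mul]
    exact (pow_eq_pow_mod _ hζ).symm
  refine ⟨{ toFun := fun g => ζ ^ (g : HolTwoPow n).left.toAdd.val, map_one' := ?_, map_mul' := ?_ },
    fun g => rfl⟩
  · simp
  · intro g h
    rw [Subgroup.coe_mul, SemidirectProduct.mul_left, toAdd_mul, hval, MonoidHom.id_apply]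
    congr 1
    have h1 := autUnits_apply (g : HolTwoPow n).right (h : HolTwoPow n).left.toAdd
    rw [ofAdd_toAdd] at h1
    rw [h1, toAdd_ofAdd, hmul]
    congr 1
    exact hS g g.2

theorem odd_val_unit (hn : 1 ≤ n) (u : (ZMod (2 ^ n))ˣ) : Odd (u : ZMod (2 ^ n)).val := by
  have h := ZMod.val_coe_unit_coprime u
  rw [Nat.coprime_pow_right_iff hn] at h
  exact Nat.coprime_two_right.1 h

/-- The commutator of `a` with the automorphism `-1` is `a ^ 2`. Conversely, the sign character `a ↦
-1` and the projection to the units both have abelian target, and their kernels meet in `⟨a ^ 2⟩`.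
-/
theorem commutator_le_iff (hn : 2 ≤ n) (N : Subgroup (HolTwoPow n)) [N.Normal] :
    commutator (HolTwoPow n) ≤ N ↔ a n ^ 2 ∈ N := by
  constructor
  · intro h
    have h1 : a n * (ofUnit n (-1)) * (a n)⁻¹ * (ofUnit n (-1))⁻¹ = a n ^ 2 := by
      have h2 : ofUnit n (-1) * a n * (ofUnit n (-1))⁻¹ = (a n)⁻¹ := by
        rw [conj_a, unitHom_ofUnit, eq_inv_iff_mul_eq_one, ← pow_succ, ← orderOf_dvd_iff_pow_eq_one]
        refine (orderOf_dvd_of_pow_eq_one a_pow_two_pow).trans ?_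
        rw [← ZMod.natCast_eq_zero_iff, Nat.cast_add, ZMod.natCast_zmod_val]
        simp
      have h3 : ofUnit n (-1) * (a n)⁻¹ * (ofUnit n (-1))⁻¹ = a n := by
        rw [← conj_inv, h2, inv_inv]
      rw [mul_assoc, mul_assoc, ← mul_assoc (ofUnit n _), h3, pow_two]
    rw [← h1]
    exact h (Subgroup.commutator_mem_commutator (Subgroup.mem_top _) (Subgroup.mem_top _))
  · intro h
    obtain ⟨l, hl⟩ := exists_character_extending (n := n) ⊤ (ζ := -1)
      (by rw [Even.neg_one_pow]; exact (Nat.even_pow.2 ⟨even_two, by omega⟩))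
      (fun g _ => (odd_val_unit (by omega) _).neg_one_pow)
    have h1 := Abelianization.commutator_subset_ker (l.comp Subgroup.topEquiv.symm.toMonoidHom)
    have h2 := Abelianization.commutator_subset_ker (unitHom n)
    intro g hg
    have hg1 : l ⟨g, trivial⟩ = 1 := h1 hg
    have hg2 : unitHom n g = 1 := h2 hg
    rw [hl] at hg1
    have heven : Even g.left.toAdd.val := by
      by_contra hodd
      rw [Nat.not_even_iff_odd] at hodd
      rw [hodd.neg_one_pow] at hg1
      have := congrArg Units.val hg1
      norm_num at this
    obtain ⟨m, hm⟩ := heven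
    rw [eq_pow_mul_ofUnit g, hg2, map_one, mul_one, hm, ← two_mul, pow_mul]
    exact N.pow_mem h m

/-- Since `a` lies in `stab n k`, only the unit part matters, and the powers of `5 ^ 2 ^ (k - 2)`
are exactly the units congruent to `1` modulo `2 ^ k`. -/
theorem mem_stab_iff {k : ℕ} (hk : 2 ≤ k) (hkn : k ≤ n) (g : HolTwoPow n) :
    g ∈ stab n k ↔ unitHom n g ∈ (ZMod.unitsMap (pow_dvd_pow 2 hkn)).ker := by
  rw [ker_unitsMap_two_pow hk hkn]
  constructor
  · intro h
    have hle : stab n k ≤ (Subgroup.zpowers (unitFive n ^ 2 ^ (k - 2))).comap (unitHom n) := by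
      rw [stab, Subgroup.closure_le]
      rintro _ (rfl | rfl)
      · rw [SetLike.mem_coe, Subgroup.mem_comap, unitHom_a]
        exact Subgroup.one_mem _
      · rw [SetLike.mem_coe, Subgroup.mem_comap, map_pow, unitHom_b, inv_pow]
        exact Subgroup.inv_mem _ (Subgroup.mem_zpowers _)
    exact hle h
  · rintro ⟨j, hj⟩
    simp only at hj
    rw [eq_pow_mul_ofUnit g]
    refine Subgroup.mul_mem _ (Subgroup.pow_mem _ (stabA n k).2 _) ?_
    have h1 : ofUnit n (unitHom n g) = (b n ^ 2 ^ (k - 2)) ^ (-j) := by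
      rw [← hj, b_eq, ← map_pow, ← map_zpow, inv_pow, inv_zpow', neg_neg]
    rw [h1]
    exact Subgroup.zpow_mem _ (stabB n k).2 _

theorem coe_stabA (k : ℕ) : (stabA n k : HolTwoPow n) = a n := rfl

theorem coe_stabB (k : ℕ) : (stabB n k : HolTwoPow n) = b n ^ 2 ^ (k - 2) := rfl

theorem stabB_pow {k : ℕ} (hk : 2 ≤ k) (hkn : k ≤ n) : stabB n k ^ 2 ^ (n - k) = 1 := by
  have h : (b n ^ 2 ^ (k - 2)) ^ 2 ^ (n - k) = 1 := by
    rw [b_eq, ← map_pow, ← map_pow, ← pow_mul, ← pow_add, inv_pow,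
      show k - 2 + (n - k) = n - 2 by omega, ← orderOf_unitFive (hk.trans hkn), pow_orderOf_eq_one,
      inv_one, map_one]
  exact Subtype.ext h

theorem orderOf_inv_unitFive_pow {k : ℕ} (hk : 2 ≤ k) (hkn : k ≤ n) :
    orderOf ((unitFive n)⁻¹ ^ 2 ^ (k - 2)) = 2 ^ (n - k) := by
  rw [orderOf_pow' _ (by positivity), orderOf_inv, orderOf_unitFive (hk.trans hkn),
    Nat.gcd_eq_right (pow_dvd_pow 2 (by omega)), Nat.pow_div (by omega) (by norm_num)]
  congr 1
  omega

/-- The character is a product: the extension of `ζ` that is trivial on the complement, times a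
character inflated from the cyclic image in the units, of order `2 ^ (n - k)`. -/
theorem exists_character_stab {k : ℕ} (hk : 2 ≤ k) (hkn : k ≤ n) {ζ ω : ℂˣ}
    (hζ : orderOf ζ = 2 ^ k) (hω : ω ^ 2 ^ (n - k) = 1) :
    ∃ l : stab n k →* ℂˣ, l (stabA n k) = ζ ∧ l (stabB n k) = ω := by
  have hζn : ζ ^ 2 ^ n = 1 := by
    rw [← orderOf_dvd_iff_pow_eq_one, hζ]
    exact pow_dvd_pow 2 hkn
  obtain ⟨l, hl⟩ := exists_character_extending (stab n k) hζn fun g hg =>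
    (pow_val_units_eq_iff hkn hζ _).2 ((mem_stab_iff hk hkn g).1 hg)
  obtain ⟨c, hc⟩ : ∃ c, c = (unitFive n)⁻¹ ^ 2 ^ (k - 2) := ⟨_, rfl⟩
  have hK : ∀ g : stab n k, unitHom n g ∈ Subgroup.zpowers c := by
    intro g
    have h1 := (mem_stab_iff hk hkn g).1 g.2
    rw [ker_unitsMap_two_pow hk hkn] at h1
    rwa [hc, inv_pow, Subgroup.zpowers_inv]
  let gen : Subgroup.zpowers c := ⟨c, Subgroup.mem_zpowers c⟩
  have hgen : ∀ x : Subgroup.zpowers c, x ∈ Subgroup.zpowers gen := by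
    rintro ⟨_, j, rfl⟩
    exact ⟨j, Subtype.ext rfl⟩
  have hord : orderOf ω ∣ orderOf gen := by
    rw [Subgroup.orderOf_mk, hc, orderOf_inv_unitFive_pow hk hkn]
    exact orderOf_dvd_of_pow_eq_one hω
  let θ : Subgroup.zpowers c →* ℂˣ := monoidHomOfForallMemZpowers hgen hord
  have hθ : θ gen = ω := monoidHomOfForallMemZpowers_apply_gen hgen hord
  let π : stab n k →* Subgroup.zpowers c := ((unitHom n).comp (stab n k).subtype).codRestrict _ hK
  refine ⟨l * θ.comp π, ?_, ?_⟩
  · have h1 : π (stabA n k) = 1 := Subtype.ext unitHom_a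
    have h2 : (stabA n k : HolTwoPow n).left.toAdd = 1 := rfl
    have : Fact (1 < 2 ^ n) := ⟨Nat.one_lt_two_pow (by omega)⟩
    rw [MonoidHom.mul_apply, MonoidHom.comp_apply, h1, map_one, mul_one, hl, h2, ZMod.val_one, pow_one]
  · have hB : unitHom n (stabB n k : HolTwoPow n) = c := by
      rw [coe_stabB, map_pow, unitHom_b, hc]
    have h1 : π (stabB n k) = gen := Subtype.ext hB
    have h2 : (stabB n k : HolTwoPow n).left = 1 := by
      rw [coe_stabB, b, ← map_pow, SemidirectProduct.left_inr]
    rw [MonoidHom.mul_apply, MonoidHom.comp_apply, h1, hθ, hl, h2, toAdd_one, ZMod.val_zero, pow_zero,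
      one_mul]

/-- A character of `stab n k` is determined by its values at the two generators. -/
theorem character_stab_ext {k : ℕ} {l l' : stab n k →* ℂˣ} (hA : l (stabA n k) = l' (stabA n k))
    (hB : l (stabB n k) = l' (stabB n k)) : l = l' := by
  have key : ∀ g (hg : g ∈ stab n k), l ⟨g, hg⟩ = l' ⟨g, hg⟩ := by
    intro g hg
    refine Subgroup.closure_induction (p := fun g hg => l ⟨g, hg⟩ = l' ⟨g, hg⟩) ?_ ?_ ?_ ?_ hg
    · rintro x (hx | hx)
      · subst hx
        exact hA
      · have hx' : x = b n ^ 2 ^ (k - 2) := hx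
        subst hx'
        exact hB
    · exact (map_one l).trans (map_one l').symm
    · intro x y hx hy ihx ihy
      have h1 : ∀ m : stab n k →* ℂˣ, m ⟨x * y, mul_mem hx hy⟩ = m ⟨x, hx⟩ * m ⟨y, hy⟩ := fun m =>
        map_mul m ⟨x, hx⟩ ⟨y, hy⟩
      rw [h1, h1, ihx, ihy]
    · intro x hx ih
      have h1 : ∀ m : stab n k →* ℂˣ, m ⟨x⁻¹, inv_mem hx⟩ = (m ⟨x, hx⟩)⁻¹ := fun m =>
        map_inv m ⟨x, hx⟩
      rw [h1, h1, ih]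
  exact MonoidHom.ext fun g => key g g.2

/-- The witnesses are `a` and its conjugate `a ^ u`: the values `ζ` and `ζ ^ u` agree only if `u` is
`1` modulo `2 ^ k`, that is, only if `g` is in the stabiliser. -/
theorem mackeyCriterion_of_isPrimitiveRoot {k : ℕ} (hk : 2 ≤ k) (hkn : k ≤ n) {l : stab n k →* ℂˣ}
    (hl : IsPrimitiveRoot (l (stabA n k) : ℂ) (2 ^ k)) : MackeyCriterion l := by
  intro g hg
  refine ⟨stabA n k, stabA n k ^ (unitHom n g : ZMod (2 ^ n)).val, ?_, fun h => hg ?_⟩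
  · rw [Subgroup.coe_pow]
    exact (conj_a g).symm
  · have hord : orderOf (l (stabA n k)) = 2 ^ k := by
      rw [hl.eq_orderOf, orderOf_units]
    rw [map_pow] at h
    exact (mem_stab_iff hk hkn g).2 ((pow_val_units_eq_iff hkn hord _).1 h.symm)

end HolTwoPow

/-! ### Rational representations nontrivial on the commutator subgroup. -/

namespace HolTwoPow

variable {n : ℕ}

section Eigenvectors

variable {W : Type} [AddCommGroup W] [Module ℂ W] {τ : Representation ℂ (HolTwoPow n) W}

theorem apply_pow_eigenvector {G : Type} [Group G] {τ : Representation ℂ G W} {g : G} {v : W} {μ : ℂ}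
    (h : τ g v = μ • v) (m : ℕ) : τ (g ^ m) v = μ ^ m • v := by
  induction m with
  | zero => simp
  | succ m ih => rw [pow_succ, map_mul, Module.End.mul_apply, h, map_smul, ih, smul_smul, pow_succ']

/-- An eigenvector for both generators of `stab n k` is an eigenvector for `stab n k`. -/
theorem exists_character_of_eigenvector {k : ℕ} {v : W} (hv : v ≠ 0) {μ ω : ℂ}
    (hA : τ (a n) v = μ • v) (hB : τ (b n ^ 2 ^ (k - 2)) v = ω • v) :
    ∃ l : stab n k →* ℂˣ, (∀ h : stab n k, τ h v = (l h : ℂ) • v) ∧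
      (l (stabA n k) : ℂ) = μ ∧ (l (stabB n k) : ℂ) = ω := by
  have hline : ∀ g ∈ stab n k, ∃ c : ℂ, τ g v = c • v := by
    intro g hg
    refine Subgroup.closure_induction (p := fun g _ => ∃ c : ℂ, τ g v = c • v) ?_ ?_ ?_ ?_ hg
    · rintro x (hx | hx)
      · exact ⟨μ, by rw [hx, hA]⟩
      · exact ⟨ω, by rw [show x = b n ^ 2 ^ (k - 2) from hx, hB]⟩
    · exact ⟨1, by rw [map_one, one_smul, Module.End.one_apply]⟩
    · rintro x y - - ⟨c, hc⟩ ⟨d, hd⟩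
      exact ⟨d * c, by rw [map_mul, Module.End.mul_apply, hd, map_smul, hc, smul_smul]⟩
    · rintro x - ⟨c, hc⟩
      have h1 : τ x⁻¹ (τ x v) = v := by
        rw [← Module.End.mul_apply, ← map_mul, inv_mul_cancel, map_one, Module.End.one_apply]
      have hc0 : c ≠ 0 := by
        rintro rfl
        rw [hc, zero_smul, map_zero] at h1
        exact hv h1.symm
      refine ⟨c⁻¹, ?_⟩
      rw [hc, map_smul] at h1
      rw [eq_inv_smul_iff₀ hc0, h1]
  obtain ⟨l, hl⟩ := exists_linearCharacter_of_forall_eigenvector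
    (τ := τ.comp (stab n k).subtype) hv fun h => hline h h.2
  refine ⟨l, hl, ?_, ?_⟩
  · exact smul_left_injective ℂ hv ((hl (stabA n k)).symm.trans hA)
  · exact smul_left_injective ℂ hv ((hl (stabB n k)).symm.trans hB)

theorem hasEigenvectorFor_of_eigenvector {k : ℕ} {l : stab n k →* ℂˣ} {v : W} (hv : v ≠ 0)
    (hA : τ (a n) v = (l (stabA n k) : ℂ) • v)
    (hB : τ (b n ^ 2 ^ (k - 2)) v = (l (stabB n k) : ℂ) • v) : HasEigenvectorFor l τ := by
  obtain ⟨l', hl', hA', hB'⟩ := exists_character_of_eigenvector hv hA hB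
  rw [character_stab_ext (Units.ext hA'.symm) (Units.ext hB'.symm)]
  exact ⟨v, hv, hl'⟩

end Eigenvectors

section Rational

variable {V : Type} [AddCommGroup V] [Module ℚ V] {ρ : Representation ℚ (HolTwoPow n) V}

/-- In an irreducible rational representation, one eigenvalue of `a` determines which powers of
`a` act trivially. -/
theorem apply_a_pow_eq_one_iff (hρ : ρ.IsIrreducible) {v : ℂ ⊗[ℚ] V} (hv : v ≠ 0) {μ : ℂ}
    (hμ : complexify ρ (a n) v = μ • v) (m : ℕ) : ρ (a n ^ m) = 1 ↔ μ ^ m = 1 := by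
  have h1 := apply_pow_eigenvector hμ m
  constructor
  · intro h
    rw [complexify_apply, h, Module.End.one_eq_id, LinearMap.baseChange_id, LinearMap.id_apply] at h1
    refine smul_left_injective ℂ hv ?_
    simpa using h1.symm
  · intro h
    refine sub_eq_zero.1 (eq_zero_of_baseChange_apply_eq_zero hρ (ρ (a n ^ m) - 1) (fun g w hw => ?_)
      hv ?_)
    -- The vectors fixed by `a ^ m` are `G`-stable because each conjugate of `a ^ m` is one of its
    -- powers.
    · rw [LinearMap.sub_apply, Module.End.one_apply, sub_eq_zero] at hw ⊢
      have hpow : ∀ j : ℕ, ρ ((a n ^ m) ^ j) w = w := by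
        intro j
        induction j with
        | zero => simp
        | succ j ih => rw [pow_succ, map_mul, Module.End.mul_apply, hw, ih]
      have h2 := conj_a_pow g⁻¹ m
      rw [inv_inv] at h2
      have h3 : a n ^ m * g = g * (g⁻¹ * a n ^ m * g) := by group
      rw [← Module.End.mul_apply, ← map_mul, h3, h2, map_mul, Module.End.mul_apply, hpow]
    · rw [LinearMap.baseChange_sub, LinearMap.sub_apply, ← complexify_apply, h1, h]
      simp [Module.End.one_eq_id]

/-- The order of an eigenvalue of `a` is the order of `ρ (a n)`, whichever eigenvector is used. -/
theorem isPrimitiveRoot_of_eigenvectors (hρ : ρ.IsIrreducible) {v w : ℂ ⊗[ℚ] V} (hv : v ≠ 0)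
    (hw : w ≠ 0) {μ ν : ℂ} (hμ : complexify ρ (a n) v = μ • v) (hν : complexify ρ (a n) w = ν • w)
    {N : ℕ} (h : IsPrimitiveRoot μ N) : IsPrimitiveRoot ν N := by
  have hiff : ∀ m : ℕ, ν ^ m = 1 ↔ μ ^ m = 1 := fun m => by
    rw [← apply_a_pow_eq_one_iff hρ hw hν, apply_a_pow_eq_one_iff hρ hv hμ]
  exact ⟨(hiff N).2 h.pow_eq_one, fun m hm => h.dvd_of_pow_eq_one m ((hiff m).1 hm)⟩

/-- Conjugation by `b ^ 2 ^ (k - 2)` raises `a` to a power congruent to `1` modulo `2 ^ k`, which is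
invisible once `a ^ 2 ^ k` acts trivially; the complement is abelian. So this element acts
centrally. -/
theorem apply_b_pow_comm {k : ℕ} (hk : 2 ≤ k) (hkn : k ≤ n) (h : ρ (a n ^ 2 ^ k) = 1)
    (g : HolTwoPow n) (v : V) :
    ρ (b n ^ 2 ^ (k - 2)) (ρ g v) = ρ g (ρ (b n ^ 2 ^ (k - 2)) v) := by
  have hmod : (unitHom n (b n ^ 2 ^ (k - 2)) : ZMod (2 ^ n)).val ≡ 1 [MOD 2 ^ k] :=
    (mem_ker_unitsMap_iff hkn _).1 ((mem_stab_iff hk hkn _).1 (stabB n k).2)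
  have ha : Commute (ρ (b n ^ 2 ^ (k - 2))) (ρ (a n)) := by
    have h1 := conj_a (b n ^ 2 ^ (k - 2))
    rw [mul_inv_eq_iff_eq_mul] at h1
    have h2 : ρ (a n) ^ (unitHom n (b n ^ 2 ^ (k - 2)) : ZMod (2 ^ n)).val = ρ (a n) := by
      rw [map_pow] at h
      rw [pow_eq_pow_mod _ h, hmod, Nat.mod_eq_of_lt (Nat.one_lt_two_pow (by omega)), pow_one]
    change ρ _ * ρ _ = ρ _ * ρ _
    rw [← map_mul, h1, map_mul, map_pow, h2]
  have hu : ∀ u, Commute (ρ (b n ^ 2 ^ (k - 2))) (ρ (ofUnit n u)) := by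
    intro u
    change ρ _ * ρ _ = ρ _ * ρ _
    rw [b_eq, ← map_pow, ← map_mul, ← map_mul, ← map_mul, ← map_mul, mul_comm]
  have hg : Commute (ρ (b n ^ 2 ^ (k - 2))) (ρ g) := by
    rw [eq_pow_mul_ofUnit g, map_mul, map_pow ρ (a n)]
    exact (ha.pow_right _).mul_right (hu _)
  exact LinearMap.congr_fun hg v

theorem nontrivial_of_isIrreducible (hρ : ρ.IsIrreducible) : Nontrivial V := by
  by_contra h
  rw [not_nontrivial_iff_subsingleton] at h
  exact bot_ne_top (α := Subrepresentation ρ)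
    (Subrepresentation.toSubmodule_injective (Subsingleton.elim _ _))

end Rational

variable (n) in
/-- The linear characters of the groups `stab n k` of order `2 ^ k` at `a`. -/
structure InertialCharacter where
  /-- the exponent of the order at `a` -/
  k : ℕ
  two_le : 2 ≤ k
  le : k ≤ n
  /-- the character -/
  toHom : stab n k →* ℂˣ
  isPrimitiveRoot : IsPrimitiveRoot (toHom (stabA n k) : ℂ) (2 ^ k)

theorem orderOf_character_stabB {k : ℕ} (hk : 2 ≤ k) (hkn : k ≤ n) (l : stab n k →* ℂˣ) :
    ∃ i ≤ n - k, orderOf (l (stabB n k)) = 2 ^ i := by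
  refine (Nat.dvd_prime_pow Nat.prime_two).1 (orderOf_dvd_of_pow_eq_one ?_)
  rw [← map_pow, stabB_pow hk hkn, map_one]

/-- The pair `(k, Φ_{2 ^ i})` attached to a character with value of order `2 ^ i` at
`b ^ 2 ^ (k - 2)`. -/
noncomputable def InertialCharacter.label (t : InertialCharacter n) : cyclotomicPairs n :=
  ⟨(t.k, Polynomial.cyclotomic (orderOf (t.toHom (stabB n t.k))) ℚ), t.two_le, t.le, by
    obtain ⟨i, hi, h⟩ := orderOf_character_stabB t.two_le t.le t.toHom
    exact ⟨i, hi, by rw [h]⟩⟩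

theorem InertialCharacter.label_eq_iff (s t : InertialCharacter n) :
    s.label = t.label ↔ s.k = t.k ∧
      orderOf (s.toHom (stabB n s.k)) = orderOf (t.toHom (stabB n t.k)) := by
  rw [Subtype.ext_iff]
  simp only [label, Prod.mk.injEq]
  exact and_congr_right fun _ => Polynomial.cyclotomic_injective.eq_iff

/-- The representation induced from an inertial character is a constituent. -/
def InertialCharacter.OccursIn (t : InertialCharacter n) (ρ : Irrep ℚ (HolTwoPow n)) : Prop :=
  IsConstituent ((linearRep t.toHom).ind (stab n t.k).subtype) (complexify ρ.rep)

theorem InertialCharacter.occursIn_iff (t : InertialCharacter n) (ρ : Irrep ℚ (HolTwoPow n)) :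
    t.OccursIn ρ ↔ HasEigenvectorFor t.toHom (complexify ρ.rep) :=
  isConstituent_ind_iff (mackeyCriterion_of_isPrimitiveRoot t.two_le t.le t.isPrimitiveRoot) _

theorem InertialCharacter.label_surjective :
    Function.Surjective (InertialCharacter.label (n := n)) := by
  rintro ⟨⟨k, f⟩, hk, hkn, i, hi, hf⟩
  simp only at hk hkn hi hf
  subst hf
  obtain ⟨ζ, hζ⟩ : ∃ ζ : ℂˣ, IsPrimitiveRoot ζ (2 ^ k) :=
    ⟨_, (Complex.isPrimitiveRoot_exp (2 ^ k) (by positivity)).isUnit_unit (by positivity)⟩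
  obtain ⟨ω, hω⟩ : ∃ ω : ℂˣ, IsPrimitiveRoot ω (2 ^ i) :=
    ⟨_, (Complex.isPrimitiveRoot_exp (2 ^ i) (by positivity)).isUnit_unit (by positivity)⟩
  obtain ⟨l, hA, hB⟩ := exists_character_stab hk hkn hζ.eq_orderOf.symm
    ((hω.pow_eq_one_iff_dvd _).2 (pow_dvd_pow 2 hi))
  refine ⟨⟨k, hk, hkn, l, ?_⟩, ?_⟩
  · rw [hA]
    exact IsPrimitiveRoot.coe_units_iff.2 hζ
  · refine Subtype.ext (Prod.ext rfl ?_)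
    simp only [label]
    rw [hB, ← hω.eq_orderOf]

theorem commutator_le_ker_iff (hn : 2 ≤ n) (ρ : Irrep ℚ (HolTwoPow n)) :
    commutator (HolTwoPow n) ≤ IrrepClass.ker (Quotient.mk _ ρ) ↔ ρ.rep (a n ^ 2) = 1 :=
  commutator_le_iff hn (MonoidHom.ker ρ.rep)

theorem exists_eigenvector_a (ρ : Irrep ℚ (HolTwoPow n)) {E : Submodule ℂ (ℂ ⊗[ℚ] ρ.V)} (hE : E ≠ ⊥)
    (haE : ∀ w ∈ E, complexify ρ.rep (a n) w ∈ E) :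
    ∃ v ∈ E, v ≠ 0 ∧ ∃ k ≤ n, ∃ μ : ℂ, complexify ρ.rep (a n) v = μ • v ∧
      IsPrimitiveRoot μ (2 ^ k) := by
  obtain ⟨v, hvE, hv, μ, hμ⟩ := exists_eigenvector_mem hE (complexify ρ.rep (a n)) haE
  have h1 : μ ^ 2 ^ n = 1 := by
    rw [← apply_a_pow_eq_one_iff ρ.irreducible hv hμ, a_pow_two_pow, map_one]
  obtain ⟨k, hk, h⟩ := (Nat.dvd_prime_pow Nat.prime_two).1 (orderOf_dvd_of_pow_eq_one h1)
  exact ⟨v, hvE, hv, k, hk, μ, hμ, h ▸ IsPrimitiveRoot.orderOf μ⟩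

theorem complexify_b_pow_comm {k : ℕ} (hk : 2 ≤ k) (hkn : k ≤ n) {ρ : Irrep ℚ (HolTwoPow n)}
    (h : ρ.rep (a n ^ 2 ^ k) = 1) (g : HolTwoPow n) (x : ℂ ⊗[ℚ] ρ.V) :
    complexify ρ.rep (b n ^ 2 ^ (k - 2)) (complexify ρ.rep g x) =
      complexify ρ.rep g (complexify ρ.rep (b n ^ 2 ^ (k - 2)) x) :=
  baseChange_complexify _ (apply_b_pow_comm hk hkn h) g x

theorem InertialCharacter.exists_occursIn (ρ : Irrep ℚ (HolTwoPow n))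
    (hρ : ρ.rep (a n ^ 2) ≠ 1) : ∃ t : InertialCharacter n, t.OccursIn ρ := by
  have := nontrivial_of_isIrreducible ρ.irreducible
  have htop : (⊤ : Submodule ℂ (ℂ ⊗[ℚ] ρ.V)) ≠ ⊥ := top_ne_bot
  obtain ⟨v, -, hv, k, hkn, μ, hμ, hprim⟩ := exists_eigenvector_a ρ htop fun _ _ => trivial
  -- For `k ≤ 1` the eigenvalue would be `1` or `-1`, and `a ^ 2` would act trivially.
  have hk : 2 ≤ k := by
    by_contra hk
    refine hρ ((apply_a_pow_eq_one_iff ρ.irreducible hv hμ 2).2 ?_)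
    rw [hprim.pow_eq_one_iff_dvd]
    exact pow_dvd_pow 2 (show k ≤ 1 by omega)
  let E := Module.End.eigenspace (complexify ρ.rep (a n)) μ
  have hE : E ≠ ⊥ := fun h => hv ((Submodule.mem_bot ℂ).1 (h ▸ Module.End.mem_eigenspace_iff.2 hμ))
  have hcomm := complexify_b_pow_comm hk hkn ((apply_a_pow_eq_one_iff ρ.irreducible hv hμ _).2
    hprim.pow_eq_one) (a n)
  -- The eigenspace of `a` is stable under the commuting operator of `b ^ 2 ^ (k - 2)`, so it
  -- contains a common eigenvector.
  obtain ⟨w, hwE, hw, ω, hω⟩ := exists_eigenvector_mem hE (complexify ρ.rep (b n ^ 2 ^ (k - 2)))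
    (fun x hx => by
      rw [Module.End.mem_eigenspace_iff] at hx ⊢
      rw [← hcomm, hx, map_smul])
  rw [Module.End.mem_eigenspace_iff] at hwE
  obtain ⟨l, hl, hA, hB⟩ := exists_character_of_eigenvector hw hwE hω
  exact ⟨⟨k, hk, hkn, l, hA ▸ hprim⟩, (occursIn_iff _ ρ).2 ⟨w, hw, hl⟩⟩

/-- The label is an invariant of `ρ`: `2 ^ k` is the order of `a` in `ρ`, and `b ^ 2 ^ (k - 2)` acts
by a self-intertwiner, whose eigenvalues are all conjugate. Conversely, the required eigenvalue of
`b ^ 2 ^ (k - 2)` occurs by conjugacy, and the value at `a` is then adjusted inside its eigenspace.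
-/
theorem InertialCharacter.occursIn_iff_label_eq {ρ : Irrep ℚ (HolTwoPow n)}
    {t : InertialCharacter n} (ht : t.OccursIn ρ) (s : InertialCharacter n) :
    s.OccursIn ρ ↔ s.label = t.label := by
  rw [label_eq_iff]
  obtain ⟨v, hv, htv⟩ := (t.occursIn_iff ρ).1 ht
  rw [occursIn_iff]
  obtain ⟨k, hk, hkn, l, hl⟩ := t
  obtain ⟨k', hk', hkn', l', hl'⟩ := s
  simp only at htv ⊢
  have hav := htv (stabA n k)
  have hbv := htv (stabB n k)
  rw [coe_stabA] at hav
  rw [coe_stabB] at hbv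
  have htriv : ρ.rep (a n ^ 2 ^ k) = 1 :=
    (apply_a_pow_eq_one_iff ρ.irreducible hv hav _).2 hl.pow_eq_one
  have hcomm := apply_b_pow_comm hk hkn htriv
  constructor
  · rintro ⟨w, hw, hsw⟩
    have haw := hsw (stabA n k')
    have hbw := hsw (stabB n k')
    rw [coe_stabA] at haw
    rw [coe_stabB] at hbw
    have hkk : k' = k := Nat.pow_right_injective le_rfl
      (hl'.unique (isPrimitiveRoot_of_eigenvectors ρ.irreducible hv hw hav haw hl))
    subst hkk
    refine ⟨rfl, ?_⟩
    have hpos : 0 < orderOf (l (stabB n k')) := by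
      obtain ⟨i, -, hi⟩ := orderOf_character_stabB hk hkn l
      rw [hi]
      positivity
    have : NeZero ((orderOf (l (stabB n k')) : ℕ) : ℂ) := ⟨Nat.cast_ne_zero.2 hpos.ne'⟩
    have hroot : Polynomial.aeval (l (stabB n k') : ℂ)
        (Polynomial.cyclotomic (orderOf (l (stabB n k'))) ℚ) = 0 := by
      rw [← Polynomial.eval_map_algebraMap, Polynomial.map_cyclotomic]
      exact (IsPrimitiveRoot.coe_units_iff.2 (IsPrimitiveRoot.orderOf _)).isRoot_cyclotomic hpos
    have h2 := aeval_minpoly_eq_zero_of_eigenvectors ρ.irreducible _ hcomm hv hw hbv hbw hroot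
    rw [← Polynomial.eval_map_algebraMap, Polynomial.map_cyclotomic] at h2
    have h3 := IsPrimitiveRoot.coe_units_iff.1 (Polynomial.isRoot_cyclotomic_iff.1 h2)
    exact h3.eq_orderOf.symm
  · rintro ⟨hkk, hord⟩
    subst hkk
    have hpos : 0 < orderOf (l (stabB n k')) := by
      obtain ⟨i, -, hi⟩ := orderOf_character_stabB hk hkn l
      rw [hi]
      positivity
    obtain ⟨w, hw, hbw⟩ := exists_eigenvector_baseChange_of_minpoly_eq _ hv hbv
      (minpoly_eq_of_isPrimitiveRoot (ν := l' (stabB n k')) hpos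
        (IsPrimitiveRoot.coe_units_iff.2 (IsPrimitiveRoot.orderOf _))
        (IsPrimitiveRoot.coe_units_iff.2 (hord ▸ IsPrimitiveRoot.orderOf _)))
    -- By centrality `E` is stable under all of `G`, so moving a vector by the complement preserves
    -- the eigenvalue of `b ^ 2 ^ (k' - 2)`.
    let E := Module.End.eigenspace (complexify ρ.rep (b n ^ 2 ^ (k' - 2))) (l' (stabB n k') : ℂ)
    have hE : E ≠ ⊥ := fun h => hw ((Submodule.mem_bot ℂ).1 (h ▸ Module.End.mem_eigenspace_iff.2 hbw))
    have hstable : ∀ g, ∀ x ∈ E, complexify ρ.rep g x ∈ E := by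
      intro g x hx
      rw [Module.End.mem_eigenspace_iff] at hx ⊢
      rw [complexify_b_pow_comm hk hkn htriv, hx, map_smul]
    obtain ⟨x, hxE, hx, -, -, μ, hμ, -⟩ := exists_eigenvector_a ρ hE (hstable _)
    have hprim := isPrimitiveRoot_of_eigenvectors ρ.irreducible hv hx hav hμ hl
    obtain ⟨m, -, hm, hpow⟩ := hprim.isPrimitiveRoot_iff.1 hl'
    have hcop : m.Coprime (2 ^ n) :=
      Nat.Coprime.pow_right n ((Nat.coprime_pow_right_iff (by omega) m 2).1 hm)
    let u : (ZMod (2 ^ n))ˣ := ZMod.unitOfCoprime m hcop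
    -- Chosen so that `a * g = g * a ^ m`: translation by `g` replaces the eigenvalue `μ` of `a` by
    -- `μ ^ m`, the prescribed one.
    let g := ofUnit n u⁻¹
    refine hasEigenvectorFor_of_eigenvector (v := complexify ρ.rep g x) ?_ ?_
      (Module.End.mem_eigenspace_iff.1 (hstable g x hxE))
    · intro h
      apply hx
      have h1 : complexify ρ.rep g⁻¹ (complexify ρ.rep g x) = x := by
        rw [← Module.End.mul_apply, ← map_mul, inv_mul_cancel, map_one, Module.End.one_apply]
      rw [← h1, h, map_zero]
    · have h1 : a n * g = g * a n ^ m := by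
        have h2 := conj_a g⁻¹
        have h3 : unitHom n g⁻¹ = u := by
          rw [map_inv, unitHom_ofUnit, inv_inv]
        have h4 : a n ^ (u : ZMod (2 ^ n)).val = a n ^ m := by
          rw [ZMod.coe_unitOfCoprime, ZMod.val_natCast]
          exact (pow_eq_pow_mod _ a_pow_two_pow).symm
        rw [h3, h4, inv_inv] at h2
        rw [← h2]
        group
      rw [← Module.End.mul_apply, ← map_mul, h1, map_mul, Module.End.mul_apply,
        apply_pow_eigenvector hμ, hpow, map_smul]

theorem InertialCharacter.exists_irrep (t : InertialCharacter n) :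
    ∃ ρ : Irrep ℚ (HolTwoPow n), ρ.rep (a n ^ 2) ≠ 1 ∧ t.OccursIn ρ := by
  obtain ⟨ρ, hρ⟩ := exists_irrep_hasEigenvectorFor t.toHom
  refine ⟨ρ, fun h => ?_, (t.occursIn_iff ρ).2 hρ⟩
  obtain ⟨v, hv, htv⟩ := hρ
  have hav := htv (stabA n t.k)
  rw [coe_stabA] at hav
  have h1 := (apply_a_pow_eq_one_iff ρ.irreducible hv hav 2).1 h
  rw [t.isPrimitiveRoot.pow_eq_one_iff_dvd] at h1
  have h2 := Nat.le_of_dvd two_pos h1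
  have h3 : 2 ^ 2 ≤ 2 ^ t.k := Nat.pow_le_pow_right two_pos t.two_le
  omega

theorem exists_equiv_cyclotomicPairs (hn : 2 ≤ n) :
    ∃ e : {π : IrrepClass ℚ (HolTwoPow n) // ¬ commutator (HolTwoPow n) ≤ π.ker} ≃
        cyclotomicPairs n,
      ∀ (ρ : Irrep ℚ (HolTwoPow n))
        (hρ : ¬ commutator (HolTwoPow n) ≤ IrrepClass.ker (Quotient.mk _ ρ))
        (t : InertialCharacter n), t.OccursIn ρ ↔ e ⟨Quotient.mk _ ρ, hρ⟩ = t.label := by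
  refine exists_equiv_of_labelling
    (S := fun π : IrrepClass ℚ (HolTwoPow n) => ¬ commutator (HolTwoPow n) ≤ π.ker)
    (R := fun (t : InertialCharacter n) (ρ : Irrep ℚ (HolTwoPow n)) => t.OccursIn ρ)
    InertialCharacter.label InertialCharacter.label_surjective ?_ ?_ ?_ ?_ ?_
  · intro ρ hρ
    rw [commutator_le_ker_iff hn] at hρ
    exact InertialCharacter.exists_occursIn ρ hρ
  · intro ρ _ t t' ht
    exact InertialCharacter.occursIn_iff_label_eq ht t'
  · intro t
    obtain ⟨ρ, h1, h2⟩ := t.exists_irrep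
    exact ⟨ρ, by rwa [commutator_le_ker_iff hn], h2⟩
  · intro t ρ σ hρ hσ
    exact irrep_equiv_of_hasEigenvectorFor
      (mackeyCriterion_of_isPrimitiveRoot t.two_le t.le t.isPrimitiveRoot) ρ σ
      ((t.occursIn_iff ρ).1 hρ) ((t.occursIn_iff σ).1 hσ)
  · intro t ρ σ h hρ
    exact (t.occursIn_iff σ).2 (((t.occursIn_iff ρ).1 hρ).of_equiv h)

end HolTwoPow

/-! ### Rational representations trivial on the commutator subgroup, and the counts. -/

namespace HolTwoPow

variable {n : ℕ}

theorem character_a_sq (hn : 2 ≤ n) (χ : HolTwoPow n →* ℂˣ) : χ (a n) ^ 2 = 1 := by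
  rw [← map_pow, ← MonoidHom.mem_ker, ← commutator_le_iff hn]
  exact Abelianization.commutator_subset_ker χ

theorem character_ofUnit_neg_one_sq (χ : HolTwoPow n →* ℂˣ) : χ (ofUnit n (-1)) ^ 2 = 1 := by
  rw [← map_pow, ← map_pow, neg_one_sq, map_one, map_one]

theorem character_b_pow (hn : 2 ≤ n) (χ : HolTwoPow n →* ℂˣ) : χ (b n) ^ 2 ^ (n - 2) = 1 := by
  rw [b_eq, ← map_pow, ← map_pow, inv_pow, ← orderOf_unitFive hn, pow_orderOf_eq_one, inv_one,
    map_one, map_one]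

/-- The holomorph is generated by `a`, `-1` and `b`. -/
theorem exists_eq_mul_zpow (hn : 2 ≤ n) (g : HolTwoPow n) :
    ∃ i j : ℤ, g = a n ^ i * b n ^ j ∨ g = a n ^ i * (ofUnit n (-1) * b n ^ j) := by
  refine ⟨(g.left.toAdd.val : ℤ), ?_⟩
  rw [zpow_natCast]
  have hb : ∀ j : ℤ, ofUnit n (unitFive n ^ j) = b n ^ (-j) := by
    intro j
    rw [b_eq, ← map_zpow, inv_zpow', neg_neg]
  rcases mem_zpowers_unitFive_or_neg hn (unitHom n g) with ⟨j, hj⟩ | ⟨j, hj⟩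
  · refine ⟨-j, Or.inl ?_⟩
    simp only at hj
    rw [← hb, hj, ← eq_pow_mul_ofUnit]
  · refine ⟨-j, Or.inr ?_⟩
    simp only at hj
    rw [← hb, hj, ← map_mul, neg_one_mul, neg_neg, ← eq_pow_mul_ofUnit]

theorem character_ext (hn : 2 ≤ n) {χ ψ : HolTwoPow n →* ℂˣ} (ha : χ (a n) = ψ (a n))
    (hc : χ (ofUnit n (-1)) = ψ (ofUnit n (-1))) (hb : χ (b n) = ψ (b n)) : χ = ψ := by
  ext g
  obtain ⟨i, j, rfl | rfl⟩ := exists_eq_mul_zpow hn g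
  · rw [map_mul, map_mul, map_zpow, map_zpow, map_zpow, map_zpow, ha, hb]
  · rw [map_mul, map_mul, map_mul, map_mul, map_zpow, map_zpow, map_zpow, map_zpow, ha, hb, hc]

/-- The invariants of a linear character of the holomorph up to Galois conjugacy. -/
noncomputable def characterInvariant (χ : HolTwoPow n →* ℂˣ) : ℂˣ × ℂˣ × ℕ :=
  (χ (a n), χ (ofUnit n (-1)), orderOf (χ (b n)))

theorem pow_odd_of_sq_eq_one {M : Type*} [Monoid M] {x : M} (hx : x ^ 2 = 1) {m : ℕ} (hm : Odd m) :
    x ^ m = x := by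
  obtain ⟨i, rfl⟩ := hm
  rw [pow_succ, pow_mul, hx, one_pow, one_mul]

/-- Equal orders at `b` give `ψ (b n) = χ (b n) ^ m` with `m` odd, and odd powers do not change the
signs at `a` and `-1`; hence `ψ = χ ^ m`. -/
theorem ker_le_of_characterInvariant_eq (hn : 2 ≤ n) {χ ψ : HolTwoPow n →* ℂˣ}
    (h : characterInvariant χ = characterInvariant ψ) : χ.ker ≤ ψ.ker := by
  simp only [characterInvariant, Prod.mk.injEq] at h
  obtain ⟨ha, hc, hb⟩ := h
  obtain ⟨m, hm, hpow⟩ : ∃ m, Odd m ∧ χ (b n) ^ m = ψ (b n) := by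
    obtain ⟨i, -, hi⟩ := (Nat.dvd_prime_pow Nat.prime_two).1
      (orderOf_dvd_of_pow_eq_one (character_b_pow hn χ))
    -- For order `1`, coprimality to the order says nothing about parity, so `m = 1` is chosen by
    -- hand.
    rcases Nat.eq_zero_or_pos i with rfl | hpos
    · rw [pow_zero] at hi
      rw [hi] at hb
      rw [orderOf_eq_one_iff] at hi
      refine ⟨1, odd_one, ?_⟩
      rw [hi, one_pow, orderOf_eq_one_iff.1 hb.symm]
    · have h1 := IsPrimitiveRoot.orderOf (ψ (b n))
      rw [← hb, ← IsPrimitiveRoot.coe_units_iff] at h1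
      have : NeZero (orderOf (χ (b n))) := ⟨by rw [hi]; positivity⟩
      have h2 : IsPrimitiveRoot (χ (b n) : ℂ) (orderOf (χ (b n))) :=
        IsPrimitiveRoot.coe_units_iff.2 (IsPrimitiveRoot.orderOf _)
      obtain ⟨m, -, hm, hpow⟩ := h2.isPrimitiveRoot_iff.1 h1
      rw [hi, Nat.coprime_pow_right_iff hpos, Nat.coprime_two_right] at hm
      exact ⟨m, hm, Units.ext (by rw [Units.val_pow_eq_pow_val, hpow])⟩
  have hψ : ψ = χ ^ m := by
    apply character_ext hn
    · rw [MonoidHom.pow_apply, pow_odd_of_sq_eq_one (character_a_sq hn χ) hm, ha]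
    · rw [MonoidHom.pow_apply, pow_odd_of_sq_eq_one (character_ofUnit_neg_one_sq χ) hm, hc]
    · rw [MonoidHom.pow_apply, hpow]
  intro g hg
  rw [MonoidHom.mem_ker] at hg ⊢
  rw [hψ, MonoidHom.pow_apply, hg, one_pow]

theorem units_sq_eq_one_iff (x : ℂˣ) : x ^ 2 = 1 ↔ x = 1 ∨ x = -1 := by
  rw [Units.ext_iff, Units.ext_iff, Units.ext_iff, Units.val_pow_eq_pow_val, Units.val_neg,
    Units.val_one]
  exact _root_.sq_eq_one_iff

theorem eq_of_sq_eq_one_of_eq_one_iff {x y : ℂˣ} (hx : x ^ 2 = 1) (hy : y ^ 2 = 1)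
    (h : x = 1 ↔ y = 1) : x = y := by
  rcases (units_sq_eq_one_iff x).1 hx with hx | hx <;>
    rcases (units_sq_eq_one_iff y).1 hy with hy | hy
  · rw [hx, hy]
  · rw [hx, h.1 hx]
  · rw [hy, h.2 hy]
  · rw [hx, hy]

theorem characterInvariant_eq_iff (hn : 2 ≤ n) (χ ψ : HolTwoPow n →* ℂˣ) :
    characterInvariant χ = characterInvariant ψ ↔ χ.ker = ψ.ker := by
  refine ⟨fun h => le_antisymm (ker_le_of_characterInvariant_eq hn h)
    (ker_le_of_characterInvariant_eq hn h.symm), fun h => ?_⟩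
  have hiff : ∀ g, χ g = 1 ↔ ψ g = 1 := fun g => by
    rw [← MonoidHom.mem_ker, h, MonoidHom.mem_ker]
  refine Prod.ext ?_ (Prod.ext ?_ ?_)
  · exact eq_of_sq_eq_one_of_eq_one_iff (character_a_sq hn χ) (character_a_sq hn ψ) (hiff _)
  · exact eq_of_sq_eq_one_of_eq_one_iff (character_ofUnit_neg_one_sq χ)
      (character_ofUnit_neg_one_sq ψ) (hiff _)
  · change orderOf (χ (b n)) = orderOf (ψ (b n))
    refine Nat.dvd_antisymm ?_ ?_ <;> apply orderOf_dvd_of_pow_eq_one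
    · rw [← map_pow, hiff, map_pow, pow_orderOf_eq_one]
    · rw [← map_pow, ← hiff, map_pow, pow_orderOf_eq_one]

theorem exists_character (hn : 2 ≤ n) {ε δ ω : ℂˣ} (hε : ε ^ 2 = 1) (hδ : δ ^ 2 = 1)
    (hω : ω ^ 2 ^ (n - 2) = 1) :
    ∃ χ : HolTwoPow n →* ℂˣ, χ (a n) = ε ∧ χ (ofUnit n (-1)) = δ ∧ χ (b n) = ω := by
  -- The inverse appears because `b` maps to the unit `5⁻¹`.
  obtain ⟨θ, hθ5, hθ1⟩ := exists_character_units hn hδ (ω := ω⁻¹) (by rw [inv_pow, hω, inv_one])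
  obtain ⟨l, hl⟩ := exists_character_extending (n := n) ⊤ (ζ := ε)
    (by rw [show n = 1 + (n - 1) by omega, pow_add, pow_mul, pow_one, hε, one_pow])
    (fun g _ => pow_odd_of_sq_eq_one hε (odd_val_unit (by omega) _))
  have hl' : ∀ g, l.comp Subgroup.topEquiv.symm.toMonoidHom g = ε ^ g.left.toAdd.val := fun g =>
    hl ⟨g, trivial⟩
  have hu : ∀ u, (ofUnit n u).left.toAdd.val = 0 := fun u => by
    have : (ofUnit n u).left = 1 := rfl
    rw [this, toAdd_one, ZMod.val_zero]
  refine ⟨l.comp Subgroup.topEquiv.symm.toMonoidHom * θ.comp (unitHom n), ?_, ?_, ?_⟩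
  · have h2 : (a n).left.toAdd = 1 := rfl
    have : Fact (1 < 2 ^ n) := ⟨Nat.one_lt_two_pow (by omega)⟩
    rw [MonoidHom.mul_apply, hl', h2, ZMod.val_one, pow_one, MonoidHom.comp_apply, unitHom_a, map_one,
      mul_one]
  · rw [MonoidHom.mul_apply, hl', hu, pow_zero, one_mul, MonoidHom.comp_apply, unitHom_ofUnit, hθ1]
  · rw [MonoidHom.mul_apply, hl', MonoidHom.comp_apply θ, unitHom_b, map_inv, hθ5, inv_inv, b_eq, hu,
      pow_zero, one_mul]

theorem range_characterInvariant (hn : 2 ≤ n) :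
    Set.range (characterInvariant (n := n)) =
      (({1, -1} ×ˢ {1, -1} ×ˢ (Finset.range (n - 1)).image (2 ^ ·) : Finset (ℂˣ × ℂˣ × ℕ)) : Set _) := by
  have hsq := units_sq_eq_one_iff
  ext ⟨ε, δ, d⟩
  simp only [Set.mem_range, Finset.coe_product, Set.mem_prod, Finset.mem_coe, Finset.mem_insert,
    Finset.mem_singleton, Finset.mem_image, Finset.mem_range]
  constructor
  · rintro ⟨χ, hχ⟩
    simp only [characterInvariant, Prod.mk.injEq] at hχ
    obtain ⟨rfl, rfl, rfl⟩ := hχ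
    refine ⟨(hsq _).1 (character_a_sq hn χ), (hsq _).1 (character_ofUnit_neg_one_sq χ), ?_⟩
    obtain ⟨i, hi, h⟩ := (Nat.dvd_prime_pow Nat.prime_two).1
      (orderOf_dvd_of_pow_eq_one (character_b_pow hn χ))
    exact ⟨i, by omega, h.symm⟩
  · rintro ⟨hε, hδ, i, hi, rfl⟩
    obtain ⟨ω, hω⟩ : ∃ ω : ℂˣ, IsPrimitiveRoot ω (2 ^ i) :=
      ⟨_, (Complex.isPrimitiveRoot_exp (2 ^ i) (by positivity)).isUnit_unit (by positivity)⟩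
    obtain ⟨χ, h1, h2, h3⟩ := exists_character hn ((hsq _).2 hε) ((hsq _).2 hδ)
      ((hω.pow_eq_one_iff_dvd _).2 (pow_dvd_pow 2 (show i ≤ n - 2 by omega)))
    exact ⟨χ, Prod.ext h1 (Prod.ext h2 (by simp only [characterInvariant]; rw [h3, ← hω.eq_orderOf]))⟩

theorem card_galoisClasses (hn : 2 ≤ n) : Nat.card (galoisClasses (HolTwoPow n)) = 4 * (n - 1) := by
  have e : galoisClasses (HolTwoPow n) ≃ Set.range (characterInvariant (n := n)) :=
    (Setoid.quotientKerEquivRange (galoisClass (G := HolTwoPow n))).symm.trans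
      ((Quotient.congrRight fun χ ψ => by
        change galoisClass χ = galoisClass ψ ↔ characterInvariant χ = characterInvariant ψ
        rw [galoisClass_eq_iff, characterInvariant_eq_iff hn]).trans
      (Setoid.quotientKerEquivRange (characterInvariant (n := n))))
  have hne : (1 : ℂˣ) ≠ -1 := fun h => by
    have := congrArg Units.val h
    norm_num at this
  rw [Nat.card_congr e, range_characterInvariant hn, Nat.card_eq_card_toFinset, Finset.toFinset_coe,
    Finset.card_product, Finset.card_product, Finset.card_pair hne,
    Finset.card_image_of_injective _ (Nat.pow_right_injective le_rfl), Finset.card_range]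
  ring

/-- The action is commutative, so successive eigenspaces for `a`, `b` and `-1` stay `G`-stable and
leave a vector on which these generators, hence all of `G`, act by scalars. -/
theorem exists_linearRep_occursIn (hn : 2 ≤ n) (ρ : Irrep ℚ (HolTwoPow n))
    (hρ : ρ.rep (a n ^ 2) = 1) : ∃ χ, IsConstituent (linearRep χ) (complexify ρ.rep) := by
  have := nontrivial_of_isIrreducible ρ.irreducible
  have hcomm : ∀ x y (v : ℂ ⊗[ℚ] ρ.V), complexify ρ.rep x (complexify ρ.rep y v) =
      complexify ρ.rep y (complexify ρ.rep x v) := fun x y v =>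
    baseChange_complexify _ (commute_of_commutator_le_ker ((commutator_le_ker_iff hn ρ).2 hρ) x) y v
  have hstep : ∀ (E : Submodule ℂ (ℂ ⊗[ℚ] ρ.V)), E ≠ ⊥ → (∀ g, ∀ x ∈ E, complexify ρ.rep g x ∈ E) →
      ∀ y, ∃ E' ≤ E, E' ≠ ⊥ ∧ (∀ g, ∀ x ∈ E', complexify ρ.rep g x ∈ E') ∧
        ∃ μ : ℂ, ∀ x ∈ E', complexify ρ.rep y x = μ • x := by
    intro E hE hstable y
    obtain ⟨v, hvE, hv, μ, hμ⟩ := exists_eigenvector_mem hE (complexify ρ.rep y) (hstable y)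
    refine ⟨E ⊓ Module.End.eigenspace (complexify ρ.rep y) μ, inf_le_left, fun h => hv ?_,
      fun g x hx => ⟨hstable g x hx.1, ?_⟩, μ, fun x hx => Module.End.mem_eigenspace_iff.1 hx.2⟩
    · rw [← Submodule.mem_bot ℂ, ← h]
      exact ⟨hvE, Module.End.mem_eigenspace_iff.2 hμ⟩
    · have h1 := Module.End.mem_eigenspace_iff.1 hx.2
      rw [SetLike.mem_coe, Module.End.mem_eigenspace_iff, hcomm, h1, map_smul]
  obtain ⟨E₁, -, hE₁, hs₁, α, hα⟩ := hstep ⊤ top_ne_bot (fun _ _ _ => trivial) (a n)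
  obtain ⟨E₂, hle₂, hE₂, hs₂, β, hβ⟩ := hstep E₁ hE₁ hs₁ (b n)
  obtain ⟨E₃, hle₃, hE₃, -, γ, hγ⟩ := hstep E₂ hE₂ hs₂ (ofUnit n (-1))
  obtain ⟨v, hv3, hv⟩ := Submodule.exists_mem_ne_zero_of_ne_bot hE₃
  have hpow : ∀ g (μ : ℂ), complexify ρ.rep g v = μ • v → ∀ i : ℤ,
      ∃ c : ℂ, complexify ρ.rep (g ^ i) v = c • v := by
    intro g μ hg i
    obtain ⟨m, hm⟩ := (mem_powers_iff_mem_zpowers.2 (Subgroup.zpow_mem_zpowers g i))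
    simp only at hm
    rw [← hm]
    exact ⟨μ ^ m, apply_pow_eigenvector hg m⟩
  obtain ⟨χ, hχ⟩ := exists_linearCharacter_of_forall_eigenvector (τ := complexify ρ.rep) hv (by
    intro g
    obtain ⟨i, j, hg⟩ := exists_eq_mul_zpow hn g
    obtain ⟨c, hc⟩ := hpow _ _ (hα v (hle₂ (hle₃ hv3))) i
    obtain ⟨d, hd⟩ := hpow _ _ (hβ v (hle₃ hv3)) j
    have hγv := hγ v hv3
    rcases hg with rfl | rfl
    · exact ⟨d * c, by rw [map_mul, Module.End.mul_apply, hd, map_smul, hc, smul_smul]⟩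
    · exact ⟨d * γ * c, by
        rw [map_mul, map_mul, Module.End.mul_apply, Module.End.mul_apply, hd, map_smul, hγv, map_smul,
          map_smul, hc, smul_smul, smul_smul]⟩)
  exact ⟨χ, (isConstituent_linearRep_iff χ _).2 ⟨v, hv, hχ⟩⟩

theorem exists_equiv_galoisClasses (hn : 2 ≤ n) :
    ∃ e : {π : IrrepClass ℚ (HolTwoPow n) // commutator (HolTwoPow n) ≤ π.ker} ≃
        galoisClasses (HolTwoPow n),
      ∀ (ρ : Irrep ℚ (HolTwoPow n))
        (hρ : commutator (HolTwoPow n) ≤ IrrepClass.ker (Quotient.mk _ ρ))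
        (χ : HolTwoPow n →* ℂˣ), IsConstituent (linearRep χ) (complexify ρ.rep) ↔
          e ⟨Quotient.mk _ ρ, hρ⟩ = ⟨galoisClass χ, χ, rfl⟩ := by
  refine exists_equiv_of_labelling
    (S := fun π : IrrepClass ℚ (HolTwoPow n) => commutator (HolTwoPow n) ≤ π.ker)
    (R := fun (χ : HolTwoPow n →* ℂˣ) (ρ : Irrep ℚ (HolTwoPow n)) =>
      IsConstituent (linearRep χ) (complexify ρ.rep))
    (fun χ => (⟨galoisClass χ, χ, rfl⟩ : galoisClasses (HolTwoPow n))) ?_ ?_ ?_ ?_ ?_ ?_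
  · rintro ⟨_, χ, rfl⟩
    exact ⟨χ, rfl⟩
  · intro ρ hρ
    exact exists_linearRep_occursIn hn ρ ((commutator_le_ker_iff hn ρ).1 hρ)
  · intro ρ hρ χ ψ hχ
    rw [isConstituent_linearRep_iff_ker_eq ρ.irreducible hρ hχ, ← galoisClass_eq_iff]
    exact ⟨fun h => Subtype.ext h, fun h => congrArg Subtype.val h⟩
  · intro χ
    obtain ⟨ρ, hρ⟩ := exists_irrep_hasEigenvectorFor (χ.comp (⊤ : Subgroup (HolTwoPow n)).subtype)
    refine ⟨ρ, (commutator_le_ker_iff hn ρ).2 ?_,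
      (isConstituent_linearRep_iff_hasEigenvectorFor χ _).2 hρ⟩
    obtain ⟨v, hv, hχv⟩ := hρ
    have hav := hχv ⟨a n, trivial⟩
    refine (apply_a_pow_eq_one_iff ρ.irreducible hv hav 2).2 ?_
    exact congrArg Units.val (character_a_sq hn χ)
  · intro χ ρ σ hρ hσ
    rw [isConstituent_linearRep_iff_hasEigenvectorFor] at hρ hσ
    exact irrep_equiv_of_hasEigenvectorFor (mackeyCriterion_top _) ρ σ hρ hσ
  · intro χ ρ σ h hρ
    rw [isConstituent_linearRep_iff_hasEigenvectorFor] at hρ ⊢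
    exact hρ.of_equiv h

/-- With `j = n - k` running over `0, …, n - 2`, there are `j + 1` exponents `i`; this reindexing is
what makes the pairs countable by a triangular sum. -/
theorem bijective_sigma_cyclotomicPairs (n : ℕ) :
    Function.Bijective (fun x : (j : Fin (n - 1)) × Fin (j + 1) =>
      (⟨(n - x.1, Polynomial.cyclotomic (2 ^ (x.2 : ℕ)) ℚ), by omega, by omega, x.2,
        by omega, rfl⟩ : cyclotomicPairs n)) := by
  constructor
  · rintro ⟨⟨j, hj⟩, i, hi⟩ ⟨⟨j', hj'⟩, i', hi'⟩ h
    have h1 := congrArg Prod.fst (congrArg Subtype.val h)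
    have h2 := congrArg Prod.snd (congrArg Subtype.val h)
    simp only at h1 h2
    have hj : j = j' := by omega
    have hi : i = i' := Nat.pow_right_injective le_rfl (Polynomial.cyclotomic_injective h2)
    subst hj hi
    rfl
  · rintro ⟨⟨k, f⟩, hk, hkn, i, hi, hf⟩
    simp only at hk hkn hi hf
    subst hf
    refine ⟨⟨⟨n - k, by omega⟩, ⟨i, by simp only; omega⟩⟩, Subtype.ext (Prod.ext ?_ rfl)⟩
    simp only
    omega

theorem card_cyclotomicPairs (n : ℕ) : Nat.card (cyclotomicPairs n) = n * (n - 1) / 2 := by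
  rw [← Nat.card_congr (Equiv.ofBijective _ (bijective_sigma_cyclotomicPairs n)),
    Nat.card_eq_fintype_card, Fintype.card_sigma]
  simp only [Fintype.card_fin]
  rw [Fin.sum_univ_eq_sum_range (fun j => j + 1), ← Finset.sum_range_id]
  cases n with
  | zero => rfl
  | succ m => rw [Finset.sum_range_succ' (fun i => i)]; rfl

instance finite_cyclotomicPairs (n : ℕ) : Finite (cyclotomicPairs n) :=
  Finite.of_equiv _ (Equiv.ofBijective _ (bijective_sigma_cyclotomicPairs n))

end HolTwoPow

/-! ### Assembly of the theorem. -/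

open HolTwoPow in
theorem theorem9p2p2 (n : ℕ) (hn : 3 ≤ n) :
    -- irreducible rational representations with `G'` in the kernel
    ((∃ e : {π : IrrepClass ℚ (HolTwoPow n) // commutator (HolTwoPow n) ≤ π.ker} ≃
          galoisClasses (HolTwoPow n),
        ∀ (ρ : Irrep ℚ (HolTwoPow n))
          (hρ : commutator (HolTwoPow n) ≤ IrrepClass.ker (Quotient.mk _ ρ))
          (χ : HolTwoPow n →* ℂˣ),
          IsConstituent (linearRep χ) (complexify ρ.rep) ↔
            χ ∈ (e ⟨Quotient.mk _ ρ, hρ⟩ : Set (HolTwoPow n →* ℂˣ))) ∧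
      Nat.card {π : IrrepClass ℚ (HolTwoPow n) // commutator (HolTwoPow n) ≤ π.ker} =
        4 * (n - 1)) ∧
    -- irreducible rational representations with `G'` not in the kernel
    (∃ e : {π : IrrepClass ℚ (HolTwoPow n) // ¬ commutator (HolTwoPow n) ≤ π.ker} ≃
          HolTwoPow.cyclotomicPairs n,
        ∀ (ρ : Irrep ℚ (HolTwoPow n))
          (hρ : ¬ commutator (HolTwoPow n) ≤ IrrepClass.ker (Quotient.mk _ ρ))
          (k : ℕ) (f : Polynomial ℚ) (hkf : (k, f) ∈ HolTwoPow.cyclotomicPairs n)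
          (ζ ω : ℂ), IsPrimitiveRoot ζ (2 ^ k) → Polynomial.aeval ω f = 0 →
          (∃! l : HolTwoPow.stab n k →* ℂˣ,
            (l (HolTwoPow.stabA n k) : ℂ) = ζ ∧ (l (HolTwoPow.stabB n k) : ℂ) = ω) ∧
          ∀ l : HolTwoPow.stab n k →* ℂˣ,
            (l (HolTwoPow.stabA n k) : ℂ) = ζ → (l (HolTwoPow.stabB n k) : ℂ) = ω →
            (IsConstituent ((linearRep l).ind (HolTwoPow.stab n k).subtype)
                (complexify ρ.rep) ↔
              e ⟨Quotient.mk _ ρ, hρ⟩ = ⟨(k, f), hkf⟩)) ∧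
    -- the total number
    Nat.card (IrrepClass ℚ (HolTwoPow n)) = 4 * (n - 1) + n * (n - 1) / 2 := by
  have hn2 : 2 ≤ n := by omega
  obtain ⟨e₁, he₁⟩ := exists_equiv_galoisClasses hn2
  obtain ⟨e₂, he₂⟩ := exists_equiv_cyclotomicPairs hn2
  have hcard₁ := (Nat.card_congr e₁).trans (card_galoisClasses hn2)
  have hcard₂ := (Nat.card_congr e₂).trans (card_cyclotomicPairs n)
  refine ⟨⟨⟨e₁, fun ρ hρ χ => ?_⟩, hcard₁⟩, ⟨e₂, fun ρ hρ k f hkf ζ ω hζ hω => ?_⟩, ?_⟩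
  · rw [he₁ ρ hρ χ]
    generalize e₁ ⟨Quotient.mk _ ρ, hρ⟩ = c
    -- For a class with representative `ψ`, equality with the class of `χ` and membership of `χ`
    -- both say that the kernels coincide.
    obtain ⟨_, ψ, rfl⟩ := c
    refine Subtype.ext_iff.trans ?_
    change galoisClass ψ = galoisClass χ ↔ χ ∈ galoisClass ψ
    rw [galoisClass_eq_iff, mem_galoisClass_iff, eq_comm]
  · obtain ⟨hk, hkn, i, hi, hf⟩ := id hkf
    simp only at hk hkn hi hf
    have hω' : IsPrimitiveRoot ω (2 ^ i) := by
      rw [hf, ← Polynomial.eval_map_algebraMap, Polynomial.map_cyclotomic] at hω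
      have : NeZero ((2 ^ i : ℕ) : ℂ) := ⟨by simp⟩
      exact Polynomial.isRoot_cyclotomic_iff.1 hω
    obtain ⟨ζ, rfl⟩ := hζ.isUnit (by positivity)
    obtain ⟨ω, rfl⟩ := hω'.isUnit (by positivity)
    rw [IsPrimitiveRoot.coe_units_iff] at hω'
    refine ⟨?_, fun l hA hB => ?_⟩
    · obtain ⟨l, hA, hB⟩ := exists_character_stab hk hkn
        (IsPrimitiveRoot.coe_units_iff.1 hζ).eq_orderOf.symm
        ((hω'.pow_eq_one_iff_dvd _).2 (pow_dvd_pow 2 hi))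
      refine ⟨l, ⟨congrArg Units.val hA, congrArg Units.val hB⟩, fun l' hl' => ?_⟩
      exact character_stab_ext ((Units.ext hl'.1).trans hA.symm) ((Units.ext hl'.2).trans hB.symm)
    · let t : InertialCharacter n := ⟨k, hk, hkn, l, hA ▸ hζ⟩
      have ht : t.label = ⟨(k, f), hkf⟩ := by
        refine Subtype.ext (Prod.ext rfl ?_)
        simp only [InertialCharacter.label, t]
        rw [Units.ext hB, ← hω'.eq_orderOf, hf]
      rw [← ht]
      exact he₂ ρ hρ t
  · classical
    have hfin₁ : Finite {π : IrrepClass ℚ (HolTwoPow n) // commutator (HolTwoPow n) ≤ π.ker} :=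
      -- `Nat.card` is `0` on infinite types, so the nonzero count `4 * (n - 1)` already gives
      -- finiteness.
      Nat.finite_of_card_ne_zero (by omega)
    have hfin₂ : Finite {π : IrrepClass ℚ (HolTwoPow n) // ¬ commutator (HolTwoPow n) ≤ π.ker} :=
      Finite.of_equiv _ e₂.symm
    rw [← hcard₁, ← hcard₂, ← Nat.card_sum]
    exact Nat.card_congr (Equiv.sumCompl _).symm
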